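/- Let $k\ge 1$ and let $\Lambda$ be the Grassmann algebra over $\mathbb C$ in the odd indeterminates $\xi_1,\dots,\xi_k,\eta_1,\dots,\eta_k$, with parity $p$ and left partial derivatives. Let $\int f\,\mathrm{vol}(\xi,\eta)$ denote the coefficient of $\xi_1\cdots\xi_k\eta_1\cdots\eta_k$ in $f\in\Lambda$. The Poisson Lie superalgebra $\mathfrak{po}(0|2k)$ is the space of symbols $K_f$, $f\in\Lambda$ (linear in $f$, with $p(K_f)=p(f)$), with the bracket $$[K_f,K_g]=-K_{\{f,g\}},\qquad \{f,g\}=-(-1)^{p(f)}\sum_{j=1}^{k}\Big(\frac{\partial f}{\partial \xi_j}\frac{\partial g}{\partial \eta_j}+\frac{\partial f}{\partial \eta_j}\frac{\partial g}{\partial \xi_j}\Big).$$ The special Hamiltonian Lie superalgebra $\mathfrak{sh}(0|2k)$ is the quotient of the ideal $\{K_f:\int f\,\mathrm{vol}=0\}$ by the center $\mathbb C K_1$; $H_f$ denotes the image of $K_f$ in it. For $A,B\subseteq \mathcal I=\{1,\dots,k\}$ put $\xi^A\eta^B=\prod_{i\in A}\xi_i\prod_{i\in B}\eta_i$ (products in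 increasing order) and $H_J=K_{\xi^J\eta^J}$ for $J\subseteq\mathcal I$. The vector $K_{\xi^A\eta^B}$ has the weight $(\mathbf 1_A(i)-\mathbf 1_B(i))_{i=1,\dots,k}$; write $\alpha>0$, and $e_\alpha=K_{\xi^A\eta^B}$, if the first nonzero coordinate of this weight is positive (the sum over $\alpha>0$ below runs over all such pairs $(A,B)$). For a monomial vector $e=K_{\xi^A\eta^B}$ let $e^*$ be the multiple of $K_{\xi^{\mathcal I\setminus A}\eta^{\mathcal I\setminus B}}$ with $B(e,e^*)=1$, where $B(K_f,K_g)=\int fg\,\mathrm{vol}(\xi,\eta)$. The form $B$ on $\mathfrak{po}(0|2k)$ is even, supersymmetric, invariant and nondegenerate, and the vectors $e^*$ are right dual to the basis of the vectors $e$, that is, $B(e,e'^*)=\delta_{e,e'}$. The element $$C_2=2\sum_{\alpha>0}e_\alpha^*e_\alpha+\sum_{J\subseteq\mathcal I}H_JH_J^*+(-2)^{k-1}H_{\mathcal I\setminus\{k\}}$$ of the enveloping algebra $U(\mathfrak{po}(0|2k))$ is the Casimir element corresponding to $B$, that is, $C_2=\sum_i u_i^*u_i$ for every homogeneous basis $(u_i)$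 with right dual vectors $u_i^*$, $B(u_i,u_j^*)=\delta_{ij}$; and $C_2$ belongs to the center of $U(\mathfrak{po}(0|2k))$. The form $B$ induces a form $B(H_f,H_g)=B(K_f,K_g)$ on $\mathfrak{sh}(0|2k)$, which is again even, supersymmetric, invariant and nondegenerate, with the induced vectors right dual as before. The Casimir element of $U(\mathfrak{sh}(0|2k))$ corresponding to it is obtained from the above formula by replacing every $K_f$ with $H_f$ and deleting the terms with $H_\emptyset$ and $H_{\mathcal I}$; that is, the summands $J=\emptyset$ and $J=\mathcal I$ are deleted, and for $k=1$ also the last summand. It belongs to the center of $U(\mathfrak{sh}(0|2k))$. -/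

import Mathlib

/-! ### Lie superalgebras, their enveloping algebras, invariant forms, Casimir elements -/

/-- The sign `(-1)^i` of a parity `i`. -/
def paritySign (i : ZMod 2) : ℤ := if i = 1 then -1 else 1

/-- The sign `(-1)^(i j)` of the sign rule for two parities `i`, `j`. -/
def koszulSign (i j : ZMod 2) : ℤ := if i = 1 ∧ j = 1 then -1 else 1

theorem parity_cases : ∀ i : ZMod 2, i = 0 ∨ i = 1 := by decide

theorem parity_one_add_one : (1 : ZMod 2) + 1 = 0 := by decide

theorem paritySign_zero : paritySign 0 = 1 := by decide

theorem paritySign_one : paritySign 1 = -1 := by decide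

theorem koszulSign_zero_left (i : ZMod 2) : koszulSign 0 i = 1 := by revert i; decide

theorem koszulSign_zero_right (i : ZMod 2) : koszulSign i 0 = 1 := by revert i; decide

theorem koszulSign_one_one : koszulSign 1 1 = -1 := by decide

/-- The structure of a Lie superalgebra over `R` on the module `L`: a decomposition of `L` into an
even part `part 0` and an odd part `part 1`, and a bilinear bracket that respects parities, is
super skew-symmetric and satisfies the super Jacobi identity. (These are the usual axioms when
`2` and `3` are invertible in `R`, in particular over `ℂ`.) -/
structure LieSuperalgebra (R L : Type*) [CommRing R] [AddCommGroup L] [Module R L] where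
  part : ZMod 2 → Submodule R L
  isCompl : IsCompl (part 0) (part 1)
  bracket : L →ₗ[R] L →ₗ[R] L
  bracket_mem : ∀ {i j : ZMod 2} {x y : L}, x ∈ part i → y ∈ part j → bracket x y ∈ part (i + j)
  skew : ∀ {i j : ZMod 2} {x y : L}, x ∈ part i → y ∈ part j →
    bracket x y = -(koszulSign i j • bracket y x)
  jacobi : ∀ {i j : ZMod 2} {x y : L}, x ∈ part i → y ∈ part j → ∀ z : L,
    bracket x (bracket y z) = bracket (bracket x y) z + koszulSign i j • bracket y (bracket x z)

/-- A bilinear map that vanishes when one of its arguments lies in `I` descends to `L ⧸ I`. -/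
def quotBilin {R L N : Type*} [CommRing R] [AddCommGroup L] [Module R L] [AddCommGroup N]
    [Module R N] (I : Submodule R L) (b : L →ₗ[R] L →ₗ[R] N)
    (hl : ∀ x ∈ I, ∀ y, b x y = 0) (hr : ∀ x, ∀ y ∈ I, b x y = 0) :
    (L ⧸ I) →ₗ[R] (L ⧸ I) →ₗ[R] N :=
  I.liftQ (I.liftQ b.flip (fun y hy => LinearMap.mem_ker.2
      (LinearMap.ext fun x => hr x y hy))).flip (fun x hx => LinearMap.mem_ker.2 (by
    ext y
    exact hl x hx y))

theorem quotBilin_mk {R L N : Type*} [CommRing R] [AddCommGroup L] [Module R L] [AddCommGroup N]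
    [Module R N] (I : Submodule R L) (b : L →ₗ[R] L →ₗ[R] N)
    (hl : ∀ x ∈ I, ∀ y, b x y = 0) (hr : ∀ x, ∀ y ∈ I, b x y = 0) (x y : L) :
    quotBilin I b hl hr (I.mkQ x) (I.mkQ y) = b x y := rfl

namespace LieSuperalgebra

variable {R L : Type*} [CommRing R] [AddCommGroup L] [Module R L]

theorem exists_add (g : LieSuperalgebra R L) (x : L) :
    ∃ y ∈ g.part 0, ∃ z ∈ g.part 1, y + z = x :=
  Submodule.mem_sup.1 (g.isCompl.sup_eq_top ▸ Submodule.mem_top)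

theorem eq_of_add_eq (g : LieSuperalgebra R L) {a b c d : L} (ha : a ∈ g.part 0)
    (hb : b ∈ g.part 1) (hc : c ∈ g.part 0) (hd : d ∈ g.part 1) (h : a + b = c + d) :
    a = c ∧ b = d := by
  have h1 : a - c = d - b := by rw [sub_eq_sub_iff_add_eq_add, h, add_comm]
  have h2 : a - c ∈ g.part 0 ⊓ g.part 1 :=
    ⟨Submodule.sub_mem _ ha hc, h1 ▸ Submodule.sub_mem _ hd hb⟩
  rw [g.isCompl.inf_eq_bot, Submodule.mem_bot] at h2
  refine ⟨sub_eq_zero.1 h2, ?_⟩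
  rw [h2] at h1
  exact (sub_eq_zero.1 h1.symm).symm

/-- A subspace is graded if it contains the even and the odd component of each of its elements. -/
def IsGraded (g : LieSuperalgebra R L) (S : Submodule R L) : Prop :=
  ∀ x ∈ S, ∃ y ∈ g.part 0, ∃ z ∈ g.part 1, y ∈ S ∧ z ∈ S ∧ y + z = x

/-- The Lie superalgebra structure on a graded subspace closed under the bracket. -/
def restrict (g : LieSuperalgebra R L) (S : Submodule R L) (hS : g.IsGraded S)
    (hb : ∀ x ∈ S, ∀ y ∈ S, g.bracket x y ∈ S) : LieSuperalgebra R S where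
  part i := (g.part i).comap S.subtype
  isCompl := by
    constructor
    · rw [Submodule.disjoint_def]
      intro x hx hy
      have : (x : L) ∈ g.part 0 ⊓ g.part 1 := ⟨hx, hy⟩
      rw [g.isCompl.inf_eq_bot, Submodule.mem_bot] at this
      exact Subtype.ext this
    · rw [codisjoint_iff, eq_top_iff]
      rintro ⟨x, hx⟩ -
      obtain ⟨y, hy, z, hz, hyS, hzS, rfl⟩ := hS x hx
      exact Submodule.mem_sup.2 ⟨⟨y, hyS⟩, hy, ⟨z, hzS⟩, hz, rfl⟩
  bracket := LinearMap.mk₂ R (fun x y => ⟨g.bracket x y, hb x x.2 y y.2⟩)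
    (fun _ _ _ => Subtype.ext (by simp)) (fun _ _ _ => Subtype.ext (by simp))
    (fun _ _ _ => Subtype.ext (by simp)) (fun _ _ _ => Subtype.ext (by simp))
  bracket_mem hx hy := g.bracket_mem hx hy
  skew hx hy := Subtype.ext (by simpa using g.skew hx hy)
  jacobi hx hy z := Subtype.ext (by simpa using g.jacobi hx hy z)

/-- The Lie superalgebra structure on the quotient by a graded ideal. -/
def quotient (g : LieSuperalgebra R L) (I : Submodule R L) (hI : g.IsGraded I)
    (hl : ∀ x ∈ I, ∀ y, g.bracket x y ∈ I) (hr : ∀ x, ∀ y ∈ I, g.bracket x y ∈ I) :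
    LieSuperalgebra R (L ⧸ I) where
  part i := (g.part i).map I.mkQ
  isCompl := by
    constructor
    · rw [Submodule.disjoint_def]
      rintro _ ⟨a, ha, rfl⟩ ⟨b, hb, hab⟩
      have h : a - b ∈ I := (Submodule.Quotient.eq I).1 hab.symm
      obtain ⟨y, hy, z, hz, hyI, -, hyz⟩ := hI _ h
      have := (g.eq_of_add_eq hy hz ha (Submodule.neg_mem _ hb) (by rw [hyz]; abel)).1
      subst this
      exact (Submodule.Quotient.mk_eq_zero I).2 hyI
    · rw [codisjoint_iff, eq_top_iff]
      intro x _
      obtain ⟨x, rfl⟩ := I.mkQ_surjective x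
      obtain ⟨y, hy, z, hz, rfl⟩ := g.exists_add x
      rw [map_add]
      exact Submodule.add_mem_sup ⟨y, hy, rfl⟩ ⟨z, hz, rfl⟩
  bracket := quotBilin I (g.bracket.compr₂ I.mkQ)
    (fun x hx y => (Submodule.Quotient.mk_eq_zero I).2 (hl x hx y))
    (fun x y hy => (Submodule.Quotient.mk_eq_zero I).2 (hr x y hy))
  bracket_mem := by
    rintro i j _ _ ⟨x, hx, rfl⟩ ⟨y, hy, rfl⟩
    exact ⟨_, g.bracket_mem hx hy, rfl⟩
  skew := by
    rintro i j _ _ ⟨x, hx, rfl⟩ ⟨y, hy, rfl⟩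
    exact (congrArg I.mkQ (g.skew hx hy)).trans (by rw [map_neg, map_zsmul]; rfl)
  jacobi := by
    rintro i j _ _ ⟨x, hx, rfl⟩ ⟨y, hy, rfl⟩ z
    obtain ⟨z, rfl⟩ := I.mkQ_surjective z
    exact (congrArg I.mkQ (g.jacobi hx hy z)).trans (by rw [map_add, map_zsmul]; rfl)

/-- The defining relations `x y - (-1)^(p(x)p(y)) y x = [x, y]` of the enveloping algebra. -/
inductive EnvRel (g : LieSuperalgebra R L) : TensorAlgebra R L → TensorAlgebra R L → Prop
  | comm {i j : ZMod 2} {x y : L} (hx : x ∈ g.part i) (hy : y ∈ g.part j) :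
      EnvRel g
        (TensorAlgebra.ι R x * TensorAlgebra.ι R y
          - koszulSign i j • (TensorAlgebra.ι R y * TensorAlgebra.ι R x))
        (TensorAlgebra.ι R (g.bracket x y))

/-- The enveloping algebra `U(g)` of a Lie superalgebra: the tensor algebra modulo `EnvRel`. -/
abbrev Env (g : LieSuperalgebra R L) : Type _ := RingQuot g.EnvRel

/-- The canonical map `g → U(g)`. -/
noncomputable def toEnv (g : LieSuperalgebra R L) : L →ₗ[R] g.Env :=
  (RingQuot.mkAlgHom R g.EnvRel).toLinearMap ∘ₗ TensorAlgebra.ι R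

/-- `B` is an even, supersymmetric, invariant, nondegenerate bilinear form on `g`. -/
structure IsInvariantForm (g : LieSuperalgebra R L) (B : L →ₗ[R] L →ₗ[R] R) : Prop where
  even : ∀ {i j : ZMod 2} {x y : L}, x ∈ g.part i → y ∈ g.part j → i ≠ j → B x y = 0
  supersymm : ∀ {i j : ZMod 2} {x y : L}, x ∈ g.part i → y ∈ g.part j →
    B x y = koszulSign i j • B y x
  invariant : ∀ x y z : L, B (g.bracket x y) z = B x (g.bracket y z)
  nondegenerate : B.Nondegenerate

/-- `u` is a homogeneous basis of `g`, and `v` is the system of right dual vectors: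
`B (u_i, v_j) = δ_ij`. -/
def IsRightDualPair (g : LieSuperalgebra R L) (B : L →ₗ[R] L →ₗ[R] R) {n : ℕ}
    (u : Module.Basis (Fin n) R L) (v : Fin n → L) : Prop :=
  (∀ i, u i ∈ g.part 0 ∨ u i ∈ g.part 1) ∧ ∀ i j, B (u i) (v j) = if i = j then 1 else 0

/-- `C` is the quadratic Casimir element of `U(g)` corresponding to the form `B` on the finite
dimensional `g`: one has `C = ∑ u_i^* u_i` for every homogeneous basis `u_i` with right dual
vectors `u_i^*`, and there is such a basis. -/
structure IsCasimir (g : LieSuperalgebra R L) (B : L →ₗ[R] L →ₗ[R] R) (C : g.Env) : Prop where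
  exists_pair : ∃ (n : ℕ) (u : Module.Basis (Fin n) R L) (v : Fin n → L), g.IsRightDualPair B u v
  eq_sum : ∀ (n : ℕ) (u : Module.Basis (Fin n) R L) (v : Fin n → L), g.IsRightDualPair B u v →
    C = ∑ i, g.toEnv (v i) * g.toEnv (u i)

end LieSuperalgebra

/-! ### The Grassmann algebra in `ξ_1, …, ξ_k, η_1, …, η_k`, derivatives and the integral -/

/-- The Grassmann algebra over `ℂ` in the odd indeterminates `ξ_1, …, ξ_k` (indexed by `Sum.inl`)
and `η_1, …, η_k` (indexed by `Sum.inr`). -/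
abbrev Grass (k : ℕ) : Type := ExteriorAlgebra ℂ (Fin k ⊕ Fin k → ℂ)

namespace Grass

variable {k : ℕ}

/-- The indeterminate `θ_a`: `ξ_i` for `a = inl i` and `η_i` for `a = inr i`. -/
noncomputable def theta (a : Fin k ⊕ Fin k) : Grass k := ExteriorAlgebra.ι ℂ (Pi.single a 1)

/-- The left partial derivative `∂/∂θ_a`: the odd superderivation with `∂θ_b/∂θ_a = δ_ab`. -/
noncomputable def pd (a : Fin k ⊕ Fin k) : Grass k →ₗ[ℂ] Grass k :=
  CliffordAlgebra.contractLeft (LinearMap.proj a : (Fin k ⊕ Fin k → ℂ) →ₗ[ℂ] ℂ)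

/-- The even (`i = 0`) and odd (`i = 1`) functions. -/
noncomputable abbrev part (i : ZMod 2) : Submodule ℂ (Grass k) :=
  CliffordAlgebra.evenOdd (0 : QuadraticForm ℂ (Fin k ⊕ Fin k → ℂ)) i

/-- The parity automorphism `f ↦ (-1)^{p(f)} f`. -/
noncomputable def sgn : Grass k →ₗ[ℂ] Grass k :=
  (CliffordAlgebra.involute (Q := (0 : QuadraticForm ℂ (Fin k ⊕ Fin k → ℂ)))).toLinearMap

/-- Successive derivatives, the first entry of the list being applied first. -/
noncomputable def pdList : List (Fin k ⊕ Fin k) → Grass k →ₗ[ℂ] Grass k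
  | [] => LinearMap.id
  | a :: l => pdList l ∘ₗ pd a

/-- The list `ξ_1, …, ξ_k, η_1, …, η_k` of all indeterminates. -/
def vars (k : ℕ) : List (Fin k ⊕ Fin k) := List.ofFn Sum.inl ++ List.ofFn Sum.inr

/-- The integral `∫ f vol(ξ, η)`, that is, the coefficient of `ξ_1 ⋯ ξ_k η_1 ⋯ η_k` in `f`: the
constant term of `∂_{η_k} ⋯ ∂_{η_1} ∂_{ξ_k} ⋯ ∂_{ξ_1} f`. -/
noncomputable def integral (k : ℕ) : Grass k →ₗ[ℂ] ℂ :=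
  (ExteriorAlgebra.algebraMapInv (R := ℂ) (M := Fin k ⊕ Fin k → ℂ)).toLinearMap ∘ₗ pdList (vars k)

/-- The monomial `ξ^A η^B = ∏_{i ∈ A} ξ_i ∏_{i ∈ B} η_i` (both products in increasing order). -/
noncomputable def mono (A B : Finset (Fin k)) : Grass k :=
  (List.ofFn fun i => if i ∈ A then theta (Sum.inl i) else 1).prod *
    (List.ofFn fun i => if i ∈ B then theta (Sum.inr i) else 1).prod

/-- The Poisson bracket
`{f, g} = -(-1)^{p(f)} ∑_j (∂f/∂ξ_j ∂g/∂η_j + ∂f/∂η_j ∂g/∂ξ_j)`. -/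
noncomputable def poisson : Grass k →ₗ[ℂ] Grass k →ₗ[ℂ] Grass k :=
  -∑ j : Fin k,
    ((LinearMap.mul ℂ (Grass k)).compl₁₂ (pd (Sum.inl j) ∘ₗ sgn) (pd (Sum.inr j)) +
      (LinearMap.mul ℂ (Grass k)).compl₁₂ (pd (Sum.inr j) ∘ₗ sgn) (pd (Sum.inl j)))

/-- The contact bracket of two functions that do not depend on the even variable, that is, minus
the Poisson bracket. -/
noncomputable def contact : Grass k →ₗ[ℂ] Grass k →ₗ[ℂ] Grass k := -poisson

/-! Auxiliary facts, needed for the definitions below. -/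

theorem sgn_one : sgn (1 : Grass k) = 1 := map_one (CliffordAlgebra.involute)

theorem sgn_mul (x y : Grass k) : sgn (x * y) = sgn x * sgn y :=
  map_mul (CliffordAlgebra.involute) x y

theorem sgn_sgn (x : Grass k) : sgn (sgn x) = x := CliffordAlgebra.involute_involute x

theorem sgn_ι (v : Fin k ⊕ Fin k → ℂ) : sgn (ExteriorAlgebra.ι ℂ v) = -ExteriorAlgebra.ι ℂ v :=
  CliffordAlgebra.involute_ι v

theorem pd_ι_mul (a : Fin k ⊕ Fin k) (v : Fin k ⊕ Fin k → ℂ) (x : Grass k) :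
    pd a (ExteriorAlgebra.ι ℂ v * x) = v a • x - ExteriorAlgebra.ι ℂ v * pd a x :=
  CliffordAlgebra.contractLeft_ι_mul _ v x

theorem pd_one (a : Fin k ⊕ Fin k) : pd a (1 : Grass k) = 0 := CliffordAlgebra.contractLeft_one _ _

theorem pd_pd (a : Fin k ⊕ Fin k) (x : Grass k) : pd a (pd a x) = 0 :=
  CliffordAlgebra.contractLeft_contractLeft _ x

theorem pd_comm (a b : Fin k ⊕ Fin k) (x : Grass k) : pd a (pd b x) = -pd b (pd a x) :=
  CliffordAlgebra.contractLeft_comm _ _ x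

theorem sgn_pd (a : Fin k ⊕ Fin k) (x : Grass k) : sgn (pd a x) = -pd a (sgn x) := by
  induction x using CliffordAlgebra.left_induction with
  | algebraMap r =>
    rw [Algebra.algebraMap_eq_smul_one]
    change sgn (pd a (r • (1 : Grass k))) = -pd a (sgn (r • (1 : Grass k)))
    simp [sgn_one, pd_one]
  | add x y hx hy => simp only [map_add, hx, hy, neg_add]
  | ι_mul x v hx =>
    change sgn (pd a (ExteriorAlgebra.ι ℂ v * x)) = -pd a (sgn (ExteriorAlgebra.ι ℂ v * x))
    rw [pd_ι_mul, sgn_mul, sgn_ι, neg_mul, map_neg, neg_neg, pd_ι_mul, map_sub, map_smul, sgn_mul,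
      sgn_ι, hx]
    simp

theorem pd_mul (a : Fin k ⊕ Fin k) (x y : Grass k) :
    pd a (x * y) = pd a x * y + sgn x * pd a y := by
  induction x using CliffordAlgebra.left_induction with
  | algebraMap r =>
    rw [Algebra.algebraMap_eq_smul_one]
    change pd a ((r • (1 : Grass k)) * y)
      = pd a (r • (1 : Grass k)) * y + sgn (r • (1 : Grass k)) * pd a y
    simp [sgn_one, pd_one]
  | add x z hx hz => simp only [map_add, add_mul, hx, hz]; abel
  | ι_mul x v hx =>
    change pd a (ExteriorAlgebra.ι ℂ v * x * y)
      = pd a (ExteriorAlgebra.ι ℂ v * x) * y + sgn (ExteriorAlgebra.ι ℂ v * x) * pd a y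
    rw [mul_assoc, pd_ι_mul, pd_ι_mul, hx, sgn_mul, sgn_ι]
    simp only [sub_mul, smul_mul_assoc, mul_add, neg_mul, mul_assoc]
    abel

theorem sgn_of_mem {i : ZMod 2} {x : Grass k} (hx : x ∈ part i) : sgn x = paritySign i • x := by
  rcases parity_cases i with rfl | rfl
  · exact (CliffordAlgebra.involute_eq_of_mem_even hx).trans (by simp [paritySign_zero])
  · exact (CliffordAlgebra.involute_eq_of_mem_odd hx).trans (by simp [paritySign_one])

theorem isCompl_part : IsCompl (part 0 : Submodule ℂ (Grass k)) (part 1) :=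
  CliffordAlgebra.evenOdd_isCompl _

theorem mem_of_sgn {i : ZMod 2} {x : Grass k} (hx : sgn x = paritySign i • x) : x ∈ part i := by
  obtain ⟨y, hy, z, hz, rfl⟩ := Submodule.mem_sup.1
    (isCompl_part.sup_eq_top ▸ Submodule.mem_top : x ∈ part 0 ⊔ part 1)
  have h2 : ∀ w : Grass k, w = -w → w = 0 := fun w hw => by
    have : (2 : ℂ) • w = 0 := by rw [two_smul]; nth_rewrite 1 [hw]; simp
    simpa using this
  rw [map_add, sgn_of_mem hy, sgn_of_mem hz] at hx
  rcases parity_cases i with rfl | rfl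
  · have : z = 0 := h2 z (by simpa [paritySign_zero, paritySign_one] using hx.symm)
    rwa [this, add_zero]
  · have : y = 0 := h2 y (by simpa [paritySign_zero, paritySign_one] using hx)
    rwa [this, zero_add]

theorem pd_mem (a : Fin k ⊕ Fin k) {i : ZMod 2} {x : Grass k} (hx : x ∈ part i) :
    pd a x ∈ part (i + 1) := by
  apply mem_of_sgn
  rw [sgn_pd, sgn_of_mem hx, map_zsmul]
  rcases parity_cases i with rfl | rfl <;>
    simp [paritySign_zero, paritySign_one, parity_one_add_one]

theorem mul_mem {i j : ZMod 2} {x y : Grass k} (hx : x ∈ part i) (hy : y ∈ part j) :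
    x * y ∈ part (i + j) :=
  CliffordAlgebra.evenOdd_mul_le _ i j (Submodule.mul_mem_mul hx hy)

theorem mul_comm_of_mem {i j : ZMod 2} {x y : Grass k} (hx : x ∈ part i) (hy : y ∈ part j) :
    x * y = koszulSign i j • (y * x) := by
  have h := CliffordAlgebra.map_mul_map_of_isOrtho_of_mem_evenOdd
    (QuadraticMap.Isometry.id (0 : QuadraticForm ℂ (Fin k ⊕ Fin k → ℂ)))
    (QuadraticMap.Isometry.id (0 : QuadraticForm ℂ (Fin k ⊕ Fin k → ℂ)))
    (fun v w => by simp [QuadraticMap.IsOrtho]) x y hx hy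
  simp only [CliffordAlgebra.map_id, AlgHom.id_apply] at h
  refine h.trans ?_
  rcases parity_cases i with rfl | rfl <;> rcases parity_cases j with rfl | rfl <;>
    simp [koszulSign_zero_left, koszulSign_zero_right, koszulSign_one_one]

theorem contact_apply (f g : Grass k) :
    contact f g = ∑ a : Fin k ⊕ Fin k, pd a (sgn f) * pd a.swap g := by
  simp [contact, poisson, Fintype.sum_sum_type, Finset.sum_add_distrib, LinearMap.sum_apply]

theorem contact_mem {i j : ZMod 2} {f g : Grass k} (hf : f ∈ part i) (hg : g ∈ part j) :
    contact f g ∈ part (i + j) := by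
  rw [contact_apply]
  refine Submodule.sum_mem _ fun a _ => ?_
  have h := mul_mem (pd_mem a (Submodule.smul_of_tower_mem _ (paritySign i) hf))
    (pd_mem a.swap hg)
  rw [sgn_of_mem hf]
  convert h using 1
  rw [add_add_add_comm, parity_one_add_one, add_zero]

theorem sum_swap (F : Fin k ⊕ Fin k → Grass k) : ∑ a : Fin k ⊕ Fin k, F a.swap = ∑ a, F a :=
  Equiv.sum_comp (Equiv.sumComm (Fin k) (Fin k)) F

theorem contact_skew {i j : ZMod 2} {f g : Grass k} (hf : f ∈ part i) (hg : g ∈ part j) :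
    contact f g = -(koszulSign i j • contact g f) := by
  rw [contact_apply, contact_apply, ← sum_swap, Finset.smul_sum, ← Finset.sum_neg_distrib]
  refine Finset.sum_congr rfl fun a _ => ?_
  rw [Sum.swap_swap, sgn_of_mem hf, sgn_of_mem hg, map_zsmul, map_zsmul, smul_mul_assoc,
    smul_mul_assoc, mul_comm_of_mem (pd_mem a.swap hf) (pd_mem a hg)]
  rcases parity_cases i with rfl | rfl <;> rcases parity_cases j with rfl | rfl <;>
    simp [koszulSign_zero_left, koszulSign_zero_right, koszulSign_one_one, paritySign_zero,
      paritySign_one, parity_one_add_one]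

theorem contact_jacobi {i j : ZMod 2} {f g : Grass k} (hf : f ∈ part i) (hg : g ∈ part j)
    (h : Grass k) : contact f (contact g h)
      = contact (contact f g) h + koszulSign i j • contact g (contact f h) := by
  have e1 : ∀ f g h : Grass k, contact f (contact g h)
      = ∑ a, ∑ b, pd a (sgn f) * pd a.swap (pd b (sgn g)) * pd b.swap h
        + ∑ a, ∑ b, pd a (sgn f) * sgn (pd b (sgn g)) * pd a.swap (pd b.swap h) := by
    intro f g h
    rw [contact_apply, contact_apply, ← Finset.sum_add_distrib]
    refine Finset.sum_congr rfl fun a _ => ?_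
    rw [map_sum, Finset.mul_sum, ← Finset.sum_add_distrib]
    refine Finset.sum_congr rfl fun b _ => ?_
    rw [pd_mul, mul_add, mul_assoc, mul_assoc]
  have e2 : contact (contact f g) h
      = ∑ a, ∑ b, pd a (sgn f) * pd a.swap (pd b (sgn g)) * pd b.swap h
        + ∑ a, ∑ b, pd b (pd a f) * pd a.swap (sgn g) * pd b.swap h := by
    rw [contact_apply, contact_apply, Finset.sum_comm, Finset.sum_comm (f := fun a b =>
      pd b (pd a f) * pd a.swap (sgn g) * pd b.swap h), ← Finset.sum_add_distrib]
    refine Finset.sum_congr rfl fun b _ => ?_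
    rw [map_sum, map_sum, Finset.sum_mul, ← Finset.sum_add_distrib]
    refine Finset.sum_congr rfl fun a _ => ?_
    have : sgn (pd a (sgn f) * pd a.swap g) = pd a f * pd a.swap (sgn g) := by
      rw [sgn_mul, sgn_pd, sgn_pd, sgn_sgn, neg_mul_neg]
    rw [this, pd_mul, sgn_pd, pd_comm b a.swap, add_mul, neg_mul_neg, add_comm]
  have e3 : koszulSign i j • ∑ a, ∑ b, pd a (sgn g) * pd a.swap (pd b (sgn f)) * pd b.swap h
      = - ∑ a, ∑ b, pd b (pd a f) * pd a.swap (sgn g) * pd b.swap h := by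
    rw [← sum_swap, Finset.smul_sum, ← Finset.sum_neg_distrib]
    refine Finset.sum_congr rfl fun a _ => ?_
    rw [Finset.smul_sum, ← Finset.sum_neg_distrib]
    refine Finset.sum_congr rfl fun b _ => ?_
    rw [Sum.swap_swap, sgn_of_mem hf, sgn_of_mem hg, pd_comm b a]
    simp only [map_zsmul, smul_mul_assoc, mul_smul_comm]
    rw [mul_comm_of_mem (pd_mem a.swap hg) (pd_mem a (pd_mem b hf))]
    rcases parity_cases i with rfl | rfl <;> rcases parity_cases j with rfl | rfl <;>
    simp [koszulSign_zero_left, koszulSign_zero_right, koszulSign_one_one, paritySign_zero,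
      paritySign_one, parity_one_add_one]
  have e4 : koszulSign i j •
        ∑ a, ∑ b, pd a (sgn g) * sgn (pd b (sgn f)) * pd a.swap (pd b.swap h)
      = ∑ a, ∑ b, pd a (sgn f) * sgn (pd b (sgn g)) * pd a.swap (pd b.swap h) := by
    rw [Finset.sum_comm, Finset.smul_sum]
    refine Finset.sum_congr rfl fun a _ => ?_
    rw [Finset.smul_sum]
    refine Finset.sum_congr rfl fun b _ => ?_
    rw [sgn_pd, sgn_pd, sgn_sgn, sgn_sgn, sgn_of_mem hf, sgn_of_mem hg, pd_comm b.swap a.swap]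
    simp only [map_zsmul, smul_mul_assoc, mul_neg, neg_mul, neg_neg]
    rw [mul_comm_of_mem (pd_mem b hg) (pd_mem a hf)]
    rcases parity_cases i with rfl | rfl <;> rcases parity_cases j with rfl | rfl <;>
    simp [koszulSign_zero_left, koszulSign_zero_right, koszulSign_one_one, paritySign_zero,
      paritySign_one, parity_one_add_one]
  rw [e1 f g h, e1 g f h, e2, smul_add, e3, e4]
  abel

theorem pdList_eq_zero {l : List (Fin k ⊕ Fin k)} {a : Fin k ⊕ Fin k} (ha : a ∈ l) :
    ∀ {x : Grass k}, pd a x = 0 → pdList l x = 0 := by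
  induction l with
  | nil => simp at ha
  | cons b l ih =>
    intro x hx
    change pdList l (pd b x) = 0
    rcases List.mem_cons.1 ha with rfl | ha
    · rw [hx, map_zero]
    · exact ih ha (by rw [pd_comm, hx, map_zero, neg_zero])

theorem mem_vars (a : Fin k ⊕ Fin k) : a ∈ vars k := by
  cases a <;> simp [vars, List.mem_ofFn]

theorem integral_eq_zero (a : Fin k ⊕ Fin k) {x : Grass k} (hx : pd a x = 0) :
    integral k x = 0 := by
  change ExteriorAlgebra.algebraMapInv (pdList (vars k) x) = 0
  rw [pdList_eq_zero (mem_vars a) hx, map_zero]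

theorem integral_pd (a : Fin k ⊕ Fin k) (x : Grass k) : integral k (pd a x) = 0 :=
  integral_eq_zero a (pd_pd a x)

theorem integral_contact (f g : Grass k) : integral k (contact f g) = 0 := by
  have h : ∀ a, integral k (pd a (sgn f) * pd a.swap g)
      = -integral k (f * pd a (pd a.swap g)) := by
    intro a
    have := integral_pd a (sgn f * pd a.swap g)
    rw [pd_mul, sgn_sgn, map_add] at this
    exact eq_neg_of_add_eq_zero_left this
  rw [contact_apply, map_sum, Finset.sum_congr rfl fun a _ => h a, Fintype.sum_sum_type,
    ← Finset.sum_add_distrib]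
  refine Finset.sum_eq_zero fun j _ => ?_
  simp only [Sum.swap_inl, Sum.swap_inr]
  rw [pd_comm (Sum.inr j) (Sum.inl j), mul_neg, map_neg, neg_neg, neg_add_cancel]

theorem integral_odd {f : Grass k} (hf : f ∈ part 1) : integral k f = 0 := by
  have h1 : ∀ (l : List (Fin k ⊕ Fin k)) (x : Grass k),
      sgn (pdList l x) = (-1 : ℂ) ^ l.length • pdList l (sgn x) := by
    intro l
    induction l with
    | nil => intro x; simp [pdList]
    | cons a l ih =>
      intro x
      change sgn (pdList l (pd a x)) = _ • pdList l (pd a (sgn x))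
      rw [ih, sgn_pd, map_neg, List.length_cons, pow_succ]
      simp
  have h2 : ∀ x : Grass k, ExteriorAlgebra.algebraMapInv (sgn x)
      = ExteriorAlgebra.algebraMapInv (R := ℂ) x := by
    intro x
    have : (ExteriorAlgebra.algebraMapInv (R := ℂ) (M := Fin k ⊕ Fin k → ℂ)).comp
        (CliffordAlgebra.involute) = ExteriorAlgebra.algebraMapInv := by
      apply ExteriorAlgebra.hom_ext
      ext v
      change ExteriorAlgebra.algebraMapInv (sgn (ExteriorAlgebra.ι ℂ _)) = _
      rw [sgn_ι]
      simp [ExteriorAlgebra.algebraMapInv]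
    exact DFunLike.congr_fun this x
  have h3 : integral k (sgn f) = integral k f := by
    change ExteriorAlgebra.algebraMapInv (pdList (vars k) (sgn f))
      = ExteriorAlgebra.algebraMapInv (pdList (vars k) f)
    rw [← h2 (pdList (vars k) f), h1]
    simp [vars, ← two_mul]
  rw [sgn_of_mem hf] at h3
  simp only [paritySign, if_true, neg_smul, one_smul, map_neg] at h3
  exact self_eq_neg.1 h3.symm

theorem pd_list_prod (a : Fin k ⊕ Fin k) (l : List (Grass k)) (hl : ∀ x ∈ l, pd a x = 0) :
    pd a l.prod = 0 := by
  induction l with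
  | nil => exact pd_one a
  | cons x l ih =>
    rw [List.prod_cons, pd_mul, hl x (by simp), ih fun y hy => hl y (by simp [hy])]
    simp

theorem pd_theta (a b : Fin k ⊕ Fin k) (h : a ≠ b) : pd a (theta b) = 0 := by
  have := pd_ι_mul a (Pi.single b 1) 1
  rw [mul_one, pd_one] at this
  simpa [theta, h] using this

/-- The integral of every monomial other than `ξ_1 ⋯ ξ_k η_1 ⋯ η_k` vanishes. -/
theorem integral_mono {A B : Finset (Fin k)} (h : (A, B) ≠ (Finset.univ, Finset.univ)) :
    integral k (mono A B) = 0 := by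
  have hAB : (∃ i, i ∉ A) ∨ ∃ i, i ∉ B := by
    by_contra! hc
    exact h (by rw [Finset.eq_univ_iff_forall.2 hc.1, Finset.eq_univ_iff_forall.2 hc.2])
  have key : ∀ a : Fin k ⊕ Fin k, (∀ i ∈ A, a ≠ Sum.inl i) → (∀ i ∈ B, a ≠ Sum.inr i) →
      integral k (mono A B) = 0 := by
    intro a h1 h2
    refine integral_eq_zero a ?_
    rw [mono, pd_mul, pd_list_prod, pd_list_prod] <;> simp only [List.mem_ofFn, zero_mul, mul_zero,
      add_zero]
    · rintro _ ⟨i, rfl⟩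
      split_ifs with hi
      exacts [pd_theta _ _ (h2 i hi), pd_one _]
    · rintro _ ⟨i, rfl⟩
      split_ifs with hi
      exacts [pd_theta _ _ (h1 i hi), pd_one _]
  rcases hAB with ⟨i, hi⟩ | ⟨i, hi⟩
  · exact key (Sum.inl i) (fun j hj e => hi (Sum.inl.inj e ▸ hj)) (fun j _ e => by cases e)
  · exact key (Sum.inr i) (fun j _ e => by cases e) (fun j hj e => hi (Sum.inr.inj e ▸ hj))

theorem pdList_prod_theta {l : List (Fin k ⊕ Fin k)} (hl : l.Nodup) :
    pdList l (l.map theta).prod = 1 := by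
  induction l with
  | nil => rfl
  | cons a l ih =>
    rw [List.nodup_cons] at hl
    have h : pd a (l.map theta).prod = 0 := pd_list_prod a _ fun x hx => by
      obtain ⟨b, hb, rfl⟩ := List.mem_map.1 hx
      exact pd_theta a b fun e => hl.1 (e ▸ hb)
    change pdList l (pd a (List.map theta (a :: l)).prod) = 1
    rw [List.map_cons, List.prod_cons, theta, pd_ι_mul, h]
    simpa using ih hl.2

/-- The normalization `∫ ξ_1 ⋯ ξ_k η_1 ⋯ η_k vol(ξ, η) = 1` of the integral. -/
theorem integral_mono_univ : integral k (mono Finset.univ Finset.univ) = 1 := by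
  have h : mono Finset.univ Finset.univ = ((vars k).map theta).prod := by
    simp [mono, vars, List.map_append, List.map_ofFn, Function.comp_def]
  have hn : (vars k).Nodup := by
    refine List.Nodup.append (List.nodup_ofFn.2 Sum.inl_injective)
      (List.nodup_ofFn.2 Sum.inr_injective) ?_
    intro x hx hy
    obtain ⟨i, rfl⟩ := List.mem_ofFn.1 hx
    obtain ⟨j, hj⟩ := List.mem_ofFn.1 hy
    cases hj
  change ExteriorAlgebra.algebraMapInv (pdList (vars k) _) = 1
  rw [h, pdList_prod_theta hn, map_one]

end Grass

/-! ### The Lie superalgebras `po(0|2k)` and `sh(0|2k)` and their invariant forms -/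

open Grass

/-- The Poisson superalgebra `po(0|2k)`, realized by generating functions: `f` stands for `K_f`,
and `[K_f, K_g] = K_{contact f g}`. -/
noncomputable def po (k : ℕ) : LieSuperalgebra ℂ (Grass k) where
  part := Grass.part
  isCompl := isCompl_part
  bracket := contact
  bracket_mem := contact_mem
  skew := contact_skew
  jacobi := contact_jacobi

/-- The form `B(K_f, K_g) = ∫ f g vol(ξ, η)` on `po(0|2k)`. -/
noncomputable def poForm (k : ℕ) : Grass k →ₗ[ℂ] Grass k →ₗ[ℂ] ℂ :=
  (LinearMap.mul ℂ (Grass k)).compr₂ (integral k)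

/-- The special Poisson superalgebra `spo(0|2k)`: the `K_f` with `∫ f vol(ξ, η) = 0`. -/
noncomputable def spoSubmodule (k : ℕ) : Submodule ℂ (Grass k) := LinearMap.ker (integral k)

theorem spo_isGraded (k : ℕ) : (po k).IsGraded (spoSubmodule k) := by
  intro x hx
  obtain ⟨y, hy, z, hz, rfl⟩ := (po k).exists_add x
  have hz0 : integral k z = 0 := integral_odd hz
  have hx' : integral k (y + z) = 0 := hx
  rw [map_add, hz0, add_zero] at hx'
  exact ⟨y, hy, z, hz, hx', hz0, rfl⟩

/-- `spo(0|2k)` as a Lie superalgebra. -/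
noncomputable def spo (k : ℕ) : LieSuperalgebra ℂ (spoSubmodule k) :=
  (po k).restrict (spoSubmodule k) (spo_isGraded k) fun x _ y _ => integral_contact x y

theorem spo_bracket_coe {k : ℕ} (x y : spoSubmodule k) :
    (((spo k).bracket x y : spoSubmodule k) : Grass k) = contact (x : Grass k) (y : Grass k) := rfl

/-- The intersection of `spo(0|2k)` with the center `ℂ K_1` of `po(0|2k)` (all of `ℂ K_1` as soon
as `k ≥ 1`). -/
noncomputable def spoCenter (k : ℕ) : Submodule ℂ (spoSubmodule k) :=
  (Submodule.span ℂ {(1 : Grass k)}).comap (spoSubmodule k).subtype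

theorem mem_spoCenter {k : ℕ} {x : spoSubmodule k} :
    x ∈ spoCenter k ↔ (x : Grass k) ∈ Submodule.span ℂ {(1 : Grass k)} := Iff.rfl

theorem contact_one_left {k : ℕ} {x : Grass k} (hx : x ∈ Submodule.span ℂ {(1 : Grass k)})
    (y : Grass k) : contact x y = 0 := by
  obtain ⟨c, rfl⟩ := Submodule.mem_span_singleton.1 hx
  rw [contact_apply]
  exact Finset.sum_eq_zero fun a _ => by rw [map_smul, sgn_one, map_smul, pd_one]; simp

theorem contact_one_right {k : ℕ} (x : Grass k) {y : Grass k}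
    (hy : y ∈ Submodule.span ℂ {(1 : Grass k)}) : contact x y = 0 := by
  obtain ⟨c, rfl⟩ := Submodule.mem_span_singleton.1 hy
  rw [contact_apply]
  exact Finset.sum_eq_zero fun a _ => by rw [map_smul, pd_one]; simp

theorem spoCenter_isGraded (k : ℕ) : (spo k).IsGraded (spoCenter k) := by
  intro x hx
  refine ⟨x, ?_, 0, Submodule.zero_mem _, hx, Submodule.zero_mem _, add_zero x⟩
  obtain ⟨c, hc⟩ := Submodule.mem_span_singleton.1 (mem_spoCenter.1 hx)
  change (x : Grass k) ∈ Grass.part 0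
  rw [← hc]
  exact Submodule.smul_mem _ _ (CliffordAlgebra.one_le_evenOdd_zero _ (Submodule.one_le.1 le_rfl))

theorem spo_bracket_eq_zero {k : ℕ} {x y : spoSubmodule k}
    (h : contact (x : Grass k) (y : Grass k) = 0) : (spo k).bracket x y = 0 :=
  Subtype.ext ((spo_bracket_coe x y).trans h)

/-- The underlying space of `sh(0|2k) = {H_f : ∫ f vol(ξ, η) = 0}`, where `H_f` is the image of
`K_f` modulo the center `ℂ K_1`. -/
abbrev ShSpace (k : ℕ) : Type := spoSubmodule k ⧸ spoCenter k

/-- The special Hamiltonian Lie superalgebra `sh(0|2k)`. -/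
noncomputable def sh (k : ℕ) : LieSuperalgebra ℂ (ShSpace k) :=
  (spo k).quotient (spoCenter k) (spoCenter_isGraded k)
    (fun x hx y => by
      rw [spo_bracket_eq_zero (contact_one_left (mem_spoCenter.1 hx) (y : Grass k))]; exact Submodule.zero_mem _)
    (fun x y hy => by
      rw [spo_bracket_eq_zero (contact_one_right (x : Grass k) (mem_spoCenter.1 hy))]; exact Submodule.zero_mem _)

/-- The element `H_f` of `sh(0|2k)`, for `f` with `∫ f vol(ξ, η) = 0`. -/
noncomputable def shH {k : ℕ} (f : Grass k) (hf : integral k f = 0) : ShSpace k :=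
  (spoCenter k).mkQ ⟨f, hf⟩

/-- The form `B(H_f, H_g) = B(K_f, K_g) = ∫ f g vol(ξ, η)` on `sh(0|2k)`. -/
noncomputable def shForm (k : ℕ) : ShSpace k →ₗ[ℂ] ShSpace k →ₗ[ℂ] ℂ :=
  quotBilin (spoCenter k)
    ((poForm k).compl₁₂ (spoSubmodule k).subtype (spoSubmodule k).subtype)
    (fun x hx y => by
      obtain ⟨c, hc⟩ := Submodule.mem_span_singleton.1 (mem_spoCenter.1 hx)
      have hy : integral k (y : Grass k) = 0 := y.2
      change integral k ((x : Grass k) * y) = 0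
      rw [← hc, smul_mul_assoc, one_mul, map_smul, hy, smul_zero])
    (fun x y hy => by
      obtain ⟨c, hc⟩ := Submodule.mem_span_singleton.1 (mem_spoCenter.1 hy)
      have hx : integral k (x : Grass k) = 0 := x.2
      change integral k ((x : Grass k) * y) = 0
      rw [← hc, mul_smul_comm, mul_one, map_smul, hx, smul_zero])

/-! ### Root vectors, right dual vectors and the elements `C_2` -/

/-- The weight of `K_{ξ^A η^B}` with respect to the small Cartan subalgebra: `α_i - β_i`, where
`α`, `β` are the exponents, that is, the indicator functions of `A` and `B`. -/
def rootWeight {k : ℕ} (p : Finset (Fin k) × Finset (Fin k)) (i : Fin k) : ℤ :=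
  (if i ∈ p.1 then 1 else 0) - (if i ∈ p.2 then 1 else 0)

/-- The weight of `K_{ξ^A η^B}` is lexicographically positive: its first nonzero entry is
positive. -/
def IsPositive {k : ℕ} (p : Finset (Fin k) × Finset (Fin k)) : Prop :=
  ∃ i, 0 < rootWeight p i ∧ ∀ j < i, rootWeight p j = 0

/-- `K_{ξ^A η^B}`: a root vector if `A ≠ B`, and the Cartan element `H_A` if `A = B`. -/
noncomputable def poVec {k : ℕ} (p : Finset (Fin k) × Finset (Fin k)) : Grass k := mono p.1 p.2

/-- The right dual vector of `K_{ξ^A η^B}` in the basis of monomials: the multiple `v` of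
the complementary monomial with `B(K_{ξ^A η^B}, v) = 1`. -/
noncomputable def poDual {k : ℕ} (p : Finset (Fin k) × Finset (Fin k)) : Grass k :=
  (poForm k (mono p.1 p.2) (mono p.1ᶜ p.2ᶜ))⁻¹ • mono p.1ᶜ p.2ᶜ

open Classical in
/-- The element
`C_2 = 2 ∑_{α > 0} e_α^* e_α + ∑_J H_J H_J^* + (-2)^(k-1) H_{I ∖ {k}}` of `U(po(0|2k))`. -/
noncomputable def poC2 (k : ℕ) : (po k).Env :=
  (2 : ℂ) • ∑ p : {p : Finset (Fin k) × Finset (Fin k) // IsPositive p},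
      (po k).toEnv (poDual p.1) * (po k).toEnv (poVec p.1)
    + ∑ J : Finset (Fin k), (po k).toEnv (poVec (J, J)) * (po k).toEnv (poDual (J, J))
    + (-2 : ℂ) ^ (k - 1) • (po k).toEnv (poVec (Finset.univ.filter fun i : Fin k => (i : ℕ) + 1 < k,
        Finset.univ.filter fun i : Fin k => (i : ℕ) + 1 < k))

/-- `H_f` for the monomial `f = ξ^A η^B`, which must not be the top one. -/
noncomputable def shVec {k : ℕ} (p : Finset (Fin k) × Finset (Fin k))
    (hp : p ≠ (Finset.univ, Finset.univ)) : ShSpace k :=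
  shH (poVec p) (integral_mono hp)

theorem integral_poDual {k : ℕ} {p : Finset (Fin k) × Finset (Fin k)} (hp : p ≠ (∅, ∅)) :
    integral k (poDual p) = 0 := by
  rw [poDual, map_smul, integral_mono, smul_zero]
  intro h
  have h1 : p.1ᶜ = Finset.univ := congrArg Prod.fst h
  have h2 : p.2ᶜ = Finset.univ := congrArg Prod.snd h
  rw [Finset.compl_eq_univ_iff] at h1 h2
  exact hp (Prod.ext h1 h2)

/-- The right dual vector in `sh(0|2k)` of `H_f`, where `f = ξ^A η^B` is not constant. -/
noncomputable def shDual {k : ℕ} (p : Finset (Fin k) × Finset (Fin k)) (hp : p ≠ (∅, ∅)) :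
    ShSpace k :=
  shH (poDual p) (integral_poDual hp)

theorem IsPositive.fst_ne_snd {k : ℕ} {p : Finset (Fin k) × Finset (Fin k)} (h : IsPositive p) :
    p.1 ≠ p.2 := by
  obtain ⟨i, hi, -⟩ := h
  intro e
  simp [rootWeight, e] at hi

theorem IsPositive.ne_empty {k : ℕ} {p : Finset (Fin k) × Finset (Fin k)} (h : IsPositive p) :
    p ≠ (∅, ∅) := fun e => h.fst_ne_snd (by rw [e])

theorem IsPositive.ne_univ {k : ℕ} {p : Finset (Fin k) × Finset (Fin k)} (h : IsPositive p) :
    p ≠ (Finset.univ, Finset.univ) := fun e => h.fst_ne_snd (by rw [e])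

theorem last_ne_univ {k : ℕ} (hk : 1 ≤ k) :
    ((Finset.univ.filter fun i : Fin k => (i : ℕ) + 1 < k,
        Finset.univ.filter fun i : Fin k => (i : ℕ) + 1 < k) : Finset (Fin k) × Finset (Fin k))
      ≠ (Finset.univ, Finset.univ) := by
  intro e
  have h := congrArg Prod.fst e
  have h1 : (⟨k - 1, by omega⟩ : Fin k) ∈ Finset.univ.filter fun i : Fin k => (i : ℕ) + 1 < k := by
    rw [show Finset.univ.filter (fun i : Fin k => (i : ℕ) + 1 < k) = Finset.univ from h]
    exact Finset.mem_univ _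
  have h2 := (Finset.mem_filter.1 h1).2
  simp only at h2
  omega

open Classical in
/-- The element `C_2` of `U(sh(0|2k))`: the formula of `poC2` with every `K_f` replaced by `H_f`,
the terms with `H_∅` and `H_I` being deleted. (For `k = 1` the last summand is a multiple of
`H_∅`, the class of the constant `1`, hence is zero.) -/
noncomputable def shC2 (k : ℕ) (hk : 1 ≤ k) : (sh k).Env :=
  (2 : ℂ) • ∑ p : {p : Finset (Fin k) × Finset (Fin k) // IsPositive p},
      (sh k).toEnv (shDual p.1 p.2.ne_empty) * (sh k).toEnv (shVec p.1 p.2.ne_univ)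
    + ∑ J : {J : Finset (Fin k) // J ≠ ∅ ∧ J ≠ Finset.univ},
        (sh k).toEnv (shVec (J.1, J.1) fun e => J.2.2 (congrArg Prod.fst e)) *
          (sh k).toEnv (shDual (J.1, J.1) fun e => J.2.1 (congrArg Prod.fst e))
    + (-2 : ℂ) ^ (k - 1) • (sh k).toEnv (shVec _ (last_ne_univ hk))

/-!
The element `∑ u_i^* u_i` does not depend on the basis `u` (`sum_dual_mul_eq_sum_dual_mul`) and is
central, because invariance makes the matrices of `ad x` in `u` and in the dual basis negative
transposes of each other, up to signs (`sum_dual_mul_mem_center`). Hence everything reduces to the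
monomial basis: it has to be shown that the monomials and their multiples `e^*` are dual, and that
`C_2` is the sum of `e^* e` over all monomials `e`.

For the first, `θ_a` times a monomial is `±` a monomial or `0`, so that the monomials span and the
product of two of them is `±` a monomial or `0`; it has a nonzero integral exactly if the two are
complementary.

For the second, complementation exchanges positive and negative weights, and the summand of a
negative root `-α` is `e_α^* e_α + (-1)^{p(e_α)} [e_α, e_α^*]`. Weight zero monomials commute with
their duals. Applying `∂/∂η_j ∂/∂ξ_j` to `e e^* = vol := ξ_1 ⋯ ξ_k η_1 ⋯ η_k` gives
`[e, e^*] = -∑_j w_j ∂/∂η_j ∂/∂ξ_j vol`, where `w` is the weight of `e` (`contact_poVec_poDual`).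
So the linear term of `C_2` comes down to the integers `∑_{α > 0} (-1)^{p(e_α)} w_j`. Sign-reversing
involutions on the pairs `(A, B)` show that they vanish for `j < k` and equal `-2^(k-1)` for
`j = k`, and `∂/∂η_k ∂/∂ξ_k vol = (-1)^(k-1) ξ^{I ∖ {k}} η^{I ∖ {k}}`.

The computation for `sh(0|2k)` is the same: `f ↦ H_f`, extended by `0` on `vol`, is a linear map
`shProj` which respects those brackets that occur, and which kills the terms with `H_∅` and `H_I`.
The lemma `sum_dual_mul_eq` is stated for an arbitrary such map and serves both algebras.
-/

/-! ### Signs -/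

theorem koszulSign_self (i : ZMod 2) : koszulSign i i = paritySign i := by revert i; decide

theorem koszulSign_one_right (i : ZMod 2) : koszulSign i 1 = paritySign i := by revert i; decide

theorem koszulSign_mul_self (i j : ZMod 2) : koszulSign i j * koszulSign i j = 1 := by
  revert i j; decide

theorem paritySign_mul_self (i : ZMod 2) : paritySign i * paritySign i = 1 := by revert i; decide

theorem paritySign_natCast (n : ℕ) : paritySign (n : ZMod 2) = (-1) ^ n := by
  rcases Nat.even_or_odd n with h | h
  · rw [h.neg_one_pow, (ZMod.natCast_eq_zero_iff_even).2 h, paritySign_zero]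
  · rw [h.neg_one_pow, (ZMod.natCast_eq_one_iff_odd).2 h, paritySign_one]

/-! ### Multiplication of monomials in the Grassmann algebra -/

namespace Grass

variable {k : ℕ}

theorem theta_mem (a : Fin k ⊕ Fin k) : theta a ∈ part (k := k) 1 :=
  CliffordAlgebra.ι_mem_evenOdd_one _ _

theorem theta_mul_theta (a b : Fin k ⊕ Fin k) : theta a * theta b = -(theta b * theta a) := by
  rw [mul_comm_of_mem (theta_mem a) (theta_mem b), koszulSign_one_one, neg_one_smul]

theorem theta_mul_self (a : Fin k ⊕ Fin k) : theta a * theta a = 0 :=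
  ExteriorAlgebra.ι_sq_zero _

theorem pd_theta_mul (a : Fin k ⊕ Fin k) (x : Grass k) :
    pd a (theta a * x) = x - theta a * pd a x := by
  rw [theta, pd_ι_mul, Pi.single_eq_same, one_smul]

/-- Moving a missing indeterminate into its place in an ordered product costs a sign `ε`. The sign
depends only on the positions of the indices, hence is the same for the products of the `ξ_i`
(`f = Sum.inl`) and of the `η_i` (`f = Sum.inr`). -/
theorem theta_mul_list_prod {l : List (Fin k)} (hl : l.Nodup) {j : Fin k} (hj : j ∈ l)
    {A : Finset (Fin k)} (hA : j ∉ A) :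
    ∃ ε : ℂ, ε * ε = 1 ∧ ∀ f : Fin k → Fin k ⊕ Fin k,
      theta (f j) * (l.map fun i => if i ∈ A then theta (f i) else 1).prod
        = ε • (l.map fun i => if i ∈ insert j A then theta (f i) else 1).prod := by
  induction l with
  | nil => simp at hj
  | cons b l ih =>
    rw [List.nodup_cons] at hl
    by_cases hb : j = b
    · subst hb
      refine ⟨1, one_mul 1, fun f => ?_⟩
      have : (l.map fun i => if i ∈ insert j A then theta (f i) else 1)
          = l.map fun i => if i ∈ A then theta (f i) else 1 := by
        refine List.map_congr_left fun i hi => ?_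
        have hij : i ≠ j := fun e => hl.1 (e ▸ hi)
        simp [hij]
      rw [List.map_cons, List.map_cons, this]
      simp [hA]
    · obtain ⟨ε, hε, h⟩ := ih hl.2 ((List.mem_cons.1 hj).resolve_left hb)
      by_cases hbA : b ∈ A
      · refine ⟨-ε, by rw [neg_mul_neg, hε], fun f => ?_⟩
        simp only [List.map_cons, List.prod_cons, hbA, Finset.mem_insert_of_mem, if_true]
        rw [← mul_assoc, theta_mul_theta, neg_mul, mul_assoc, h f, mul_smul_comm, neg_smul]
      · refine ⟨ε, hε, fun f => ?_⟩
        have hb' : b ∉ insert j A := by simp [hbA, Ne.symm hb]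
        simp only [List.map_cons, List.prod_cons, hbA, hb', if_false, one_mul]
        exact h f

/-- The product `∏_{i ∈ A} θ_{f(i)}` in increasing order; `mono A B` is the product of those for
`f = Sum.inl` and for `f = Sum.inr`. -/
noncomputable def orderedProd (f : Fin k → Fin k ⊕ Fin k) (A : Finset (Fin k)) : Grass k :=
  (List.ofFn fun i => if i ∈ A then theta (f i) else 1).prod

theorem mono_eq (A B : Finset (Fin k)) :
    mono A B = orderedProd Sum.inl A * orderedProd Sum.inr B := rfl

theorem orderedProd_empty (f : Fin k → Fin k ⊕ Fin k) : orderedProd f ∅ = 1 := by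
  simp [orderedProd]

theorem theta_mul_orderedProd {j : Fin k} {A : Finset (Fin k)} (hA : j ∉ A) :
    ∃ ε : ℂ, ε * ε = 1 ∧ ∀ f : Fin k → Fin k ⊕ Fin k,
      theta (f j) * orderedProd f A = ε • orderedProd f (insert j A) := by
  simp only [orderedProd, List.ofFn_eq_map]
  exact theta_mul_list_prod (List.nodup_finRange k) (List.mem_finRange j) hA

theorem orderedProd_mem (f : Fin k → Fin k ⊕ Fin k) (A : Finset (Fin k)) :
    orderedProd f A ∈ part (k := k) (A.card : ZMod 2) := by
  induction A using Finset.induction_on with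
  | empty =>
    rw [orderedProd_empty, Finset.card_empty, Nat.cast_zero]
    exact SetLike.GradedOne.one_mem
  | insert j A hj ih =>
    obtain ⟨ε, hε, h⟩ := theta_mul_orderedProd hj
    have e : orderedProd f (insert j A) = ε • (theta (f j) * orderedProd f A) := by
      rw [h f, smul_smul, hε, one_smul]
    rw [e, Finset.card_insert_of_notMem hj, Nat.cast_add, Nat.cast_one, add_comm]
    exact Submodule.smul_mem _ _ (SetLike.mul_mem_graded (theta_mem _) ih)

/-- The parity of the monomial `ξ^A η^B`. -/
def deg (p : Finset (Fin k) × Finset (Fin k)) : ZMod 2 := ((p.1.card + p.2.card : ℕ) : ZMod 2)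

theorem mono_mem (A B : Finset (Fin k)) : mono A B ∈ part (k := k) (deg (A, B)) := by
  rw [deg, Nat.cast_add]
  exact SetLike.mul_mem_graded (orderedProd_mem _ _) (orderedProd_mem _ _)

/-- The monomial with a given set of indeterminates. -/
noncomputable def setMono (S : Finset (Fin k ⊕ Fin k)) : Grass k := mono S.toLeft S.toRight

theorem mono_eq_setMono (A B : Finset (Fin k)) : mono A B = setMono (A.disjSum B) := by
  rw [setMono, Finset.toLeft_disjSum, Finset.toRight_disjSum]

theorem setMono_empty : setMono (∅ : Finset (Fin k ⊕ Fin k)) = 1 := by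
  simp [setMono, mono]

theorem theta_mul_setMono_of_notMem {a : Fin k ⊕ Fin k} {S : Finset (Fin k ⊕ Fin k)} (ha : a ∉ S) :
    ∃ ε : ℂ, ε * ε = 1 ∧ theta a * setMono S = ε • setMono (insert a S) := by
  rcases a with j | j
  · obtain ⟨ε, hε, h⟩ := theta_mul_orderedProd (j := j) (A := S.toLeft) (by simpa using ha)
    refine ⟨ε, hε, ?_⟩
    rw [setMono, setMono, Finset.toLeft_insert_inl, Finset.toRight_insert_inl, mono_eq, mono_eq,
      ← mul_assoc, h Sum.inl, smul_mul_assoc]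
  · obtain ⟨ε, hε, h⟩ := theta_mul_orderedProd (j := j) (A := S.toRight) (by simpa using ha)
    set s : ℤ := paritySign (S.toLeft.card : ZMod 2) with hs
    refine ⟨s * ε, ?_, ?_⟩
    · rw [mul_mul_mul_comm, hε, mul_one, ← Int.cast_mul, hs, paritySign_mul_self, Int.cast_one]
    · have hc : theta (Sum.inr j) * orderedProd Sum.inl S.toLeft
          = s • (orderedProd Sum.inl S.toLeft * theta (Sum.inr j)) := by
        rw [mul_comm_of_mem (orderedProd_mem Sum.inl S.toLeft) (theta_mem (Sum.inr j)),
          koszulSign_one_right, smul_smul, paritySign_mul_self, one_smul]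
      rw [setMono, setMono, Finset.toLeft_insert_inr, Finset.toRight_insert_inr, mono_eq, mono_eq,
        ← mul_assoc, hc, smul_mul_assoc, mul_assoc, h Sum.inr, mul_smul_comm, mul_smul,
        Int.cast_smul_eq_zsmul]

theorem setMono_insert {a : Fin k ⊕ Fin k} {S : Finset (Fin k ⊕ Fin k)} (ha : a ∉ S) :
    ∃ ε : ℂ, ε * ε = 1 ∧ setMono (insert a S) = ε • (theta a * setMono S) := by
  obtain ⟨ε, hε, h⟩ := theta_mul_setMono_of_notMem ha
  exact ⟨ε, hε, by rw [h, smul_smul, hε, one_smul]⟩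

theorem theta_mul_setMono_of_mem {a : Fin k ⊕ Fin k} {S : Finset (Fin k ⊕ Fin k)} (ha : a ∈ S) :
    theta a * setMono S = 0 := by
  obtain ⟨ε, -, h⟩ := setMono_insert (Finset.notMem_erase a S)
  rw [Finset.insert_erase ha] at h
  rw [h, mul_smul_comm, ← mul_assoc, theta_mul_self, zero_mul, smul_zero]

theorem pd_setMono_of_notMem {a : Fin k ⊕ Fin k} {S : Finset (Fin k ⊕ Fin k)} (ha : a ∉ S) :
    pd a (setMono S) = 0 := by
  rw [setMono, mono, pd_mul, pd_list_prod, pd_list_prod] <;>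
    simp only [List.mem_ofFn, zero_mul, mul_zero, add_zero]
  · rintro _ ⟨i, rfl⟩
    split_ifs with hi
    exacts [pd_theta _ _ fun e => ha (e ▸ Finset.mem_toRight.1 hi), pd_one _]
  · rintro _ ⟨i, rfl⟩
    split_ifs with hi
    exacts [pd_theta _ _ fun e => ha (e ▸ Finset.mem_toLeft.1 hi), pd_one _]

theorem setMono_mul_of_not_disjoint {S T : Finset (Fin k ⊕ Fin k)} (h : ¬Disjoint S T) :
    setMono S * setMono T = 0 := by
  obtain ⟨a, haS, haT⟩ := Finset.not_disjoint_iff.1 h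
  obtain ⟨ε, -, hε⟩ := setMono_insert (Finset.notMem_erase a S)
  rw [Finset.insert_erase haS] at hε
  obtain ⟨d, hd⟩ : ∃ d, setMono (S.erase a) ∈ part (k := k) d := ⟨_, mono_mem _ _⟩
  rw [hε, smul_mul_assoc, mul_comm_of_mem (theta_mem a) hd, smul_mul_assoc, mul_assoc,
    theta_mul_setMono_of_mem haT, mul_zero, smul_zero, smul_zero]

theorem setMono_mul_of_disjoint {S T : Finset (Fin k ⊕ Fin k)} (h : Disjoint S T) :
    ∃ ε : ℂ, ε * ε = 1 ∧ setMono S * setMono T = ε • setMono (S ∪ T) := by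
  induction S using Finset.induction_on with
  | empty => exact ⟨1, one_mul 1, by rw [setMono_empty, one_mul, one_smul, Finset.empty_union]⟩
  | insert a S ha ih =>
    rw [Finset.disjoint_insert_left] at h
    obtain ⟨ε₁, h₁, e₁⟩ := setMono_insert ha
    obtain ⟨ε₂, h₂, e₂⟩ := ih h.2
    obtain ⟨ε₃, h₃, e₃⟩ := theta_mul_setMono_of_notMem (a := a) (S := S ∪ T) (by simp [ha, h.1])
    refine ⟨ε₁ * (ε₂ * ε₃), ?_, ?_⟩
    · rw [mul_mul_mul_comm, mul_mul_mul_comm ε₂, h₁, h₂, h₃, one_mul, one_mul]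
    · rw [e₁, smul_mul_assoc, mul_assoc, e₂, mul_smul_comm, e₃, smul_smul, smul_smul, mul_assoc,
        Finset.insert_union]

theorem span_setMono : Submodule.span ℂ (Set.range (setMono (k := k))) = ⊤ := by
  have hθ : ∀ (a : Fin k ⊕ Fin k) (x : Grass k),
      x ∈ Submodule.span ℂ (Set.range (setMono (k := k))) →
      theta a * x ∈ Submodule.span ℂ (Set.range (setMono (k := k))) := by
    intro a x hx
    induction hx using Submodule.span_induction with
    | mem x hx =>
      obtain ⟨S, rfl⟩ := hx
      by_cases ha : a ∈ S
      · rw [theta_mul_setMono_of_mem ha]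
        exact Submodule.zero_mem _
      · obtain ⟨ε, -, h⟩ := theta_mul_setMono_of_notMem ha
        rw [h]
        exact Submodule.smul_mem _ _ (Submodule.subset_span ⟨_, rfl⟩)
    | zero => rw [mul_zero]; exact Submodule.zero_mem _
    | add x y _ _ hx hy => rw [mul_add]; exact Submodule.add_mem _ hx hy
    | smul c x _ hx => rw [mul_smul_comm]; exact Submodule.smul_mem _ _ hx
  refine eq_top_iff.2 fun x _ => ?_
  induction x using CliffordAlgebra.left_induction with
  | algebraMap r =>
    rw [Algebra.algebraMap_eq_smul_one]
    exact Submodule.smul_mem _ _ (Submodule.subset_span ⟨∅, setMono_empty⟩)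
  | add x y hx hy => exact Submodule.add_mem _ (hx trivial) (hy trivial)
  | ι_mul x v hx =>
    have hv : ExteriorAlgebra.ι ℂ v = ∑ a, v a • theta a := by
      have := (Pi.basisFun ℂ (Fin k ⊕ Fin k)).sum_repr v
      conv_lhs => rw [← this, map_sum]
      exact Finset.sum_congr rfl fun a _ => by simp [theta]
    change ExteriorAlgebra.ι ℂ v * x ∈ _
    rw [hv, Finset.sum_mul]
    refine Submodule.sum_mem _ fun a _ => ?_
    rw [smul_mul_assoc]
    exact Submodule.smul_mem _ _ (hθ a x (hx trivial))

/-- `ξ_1 ⋯ ξ_k η_1 ⋯ η_k` with the factors `ξ_j`, `η_j` moved to the front. The signs of moving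
`ξ_j` and `η_j` to the front of their own products are equal and cancel; what remains is the sign
of moving `η_j` past the other `k - 1` factors `ξ_i`. -/
theorem mono_univ_eq (j : Fin k) :
    mono (Finset.univ : Finset (Fin k)) Finset.univ = (-1 : ℂ) ^ (k - 1) •
      (theta (Sum.inl j) * (theta (Sum.inr j) *
        mono (Finset.univ.erase j) (Finset.univ.erase j))) := by
  obtain ⟨ε, hε, h⟩ := theta_mul_orderedProd (Finset.notMem_erase j Finset.univ)
  rw [Finset.insert_erase (Finset.mem_univ j)] at h
  have e : ∀ f : Fin k → Fin k ⊕ Fin k, orderedProd f Finset.univ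
      = ε • (theta (f j) * orderedProd f (Finset.univ.erase j)) := fun f => by
    rw [h f, smul_smul, hε, one_smul]
  have hc := mul_comm_of_mem (orderedProd_mem Sum.inl (Finset.univ.erase j))
    (theta_mem (Sum.inr j))
  rw [koszulSign_one_right, paritySign_natCast, Finset.card_erase_of_mem (Finset.mem_univ j),
    Finset.card_univ, Fintype.card_fin] at hc
  rw [mono_eq, e, e, smul_mul_assoc, mul_smul_comm, smul_smul, hε, one_smul, mul_assoc,
    ← mul_assoc (orderedProd _ _), hc, smul_mul_assoc, mul_smul_comm, mono_eq, mul_assoc,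
    ← Int.cast_smul_eq_zsmul ℂ]
  push_cast
  rfl

theorem pd_pd_mono_univ (j : Fin k) :
    pd (Sum.inr j) (pd (Sum.inl j) (mono (Finset.univ : Finset (Fin k)) Finset.univ))
      = (-1 : ℂ) ^ (k - 1) • mono (Finset.univ.erase j) (Finset.univ.erase j) := by
  have hl : pd (Sum.inl j) (mono (Finset.univ.erase j) (Finset.univ.erase j)) = 0 := by
    rw [mono_eq_setMono]
    exact pd_setMono_of_notMem (by simp)
  have hr : pd (Sum.inr j) (mono (Finset.univ.erase j) (Finset.univ.erase j)) = 0 := by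
    rw [mono_eq_setMono]
    exact pd_setMono_of_notMem (by simp)
  rw [mono_univ_eq j, map_smul, map_smul, pd_theta_mul, pd_mul, pd_theta _ _ (by simp), hl]
  simp [pd_theta_mul, hr]

end Grass

/-! ### Dual families and Casimir elements of Lie superalgebras -/

section DualFamilies

variable {K L ι : Type*} [Field K] [AddCommGroup L] [Module K L] [Fintype ι] [DecidableEq ι]
  {B : L →ₗ[K] L →ₗ[K] K} {u v : ι → L}

theorem linearIndependent_of_dual (huv : ∀ i j, B (u i) (v j) = if i = j then 1 else 0) :
    LinearIndependent K u := by
  refine Fintype.linearIndependent_iff.2 fun c hc i => ?_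
  have := congrArg (fun x => B x (v i)) hc
  simpa [LinearMap.sum_apply, huv] using this

theorem sum_left_dual (huv : ∀ i j, B (u i) (v j) = if i = j then 1 else 0)
    (hu : Submodule.span K (Set.range u) = ⊤) (x : L) : ∑ i, B x (v i) • u i = x := by
  obtain ⟨c, rfl⟩ := (Submodule.mem_span_range_iff_exists_fun K).1 (hu ▸ Submodule.mem_top : x ∈ _)
  simp [LinearMap.sum_apply, huv]

theorem sum_right_dual (huv : ∀ i j, B (u i) (v j) = if i = j then 1 else 0)
    (hu : Submodule.span K (Set.range u) = ⊤) (hB : B.Nondegenerate) (y : L) :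
    ∑ i, B (u i) y • v i = y := by
  refine sub_eq_zero.1 (hB.2 _ fun x => ?_)
  rw [← sum_left_dual huv hu x]
  simp [LinearMap.sum_apply, huv]

/-- A family dual to a basis is linearly independent, hence by dimension a basis too. -/
theorem nondegenerate_of_dual (huv : ∀ i j, B (u i) (v j) = if i = j then 1 else 0)
    (hu : Submodule.span K (Set.range u) = ⊤) : B.Nondegenerate := by
  have hvi : LinearIndependent K v := linearIndependent_of_dual (B := B.flip) (v := u) fun i j => by
    rw [LinearMap.flip_apply, huv]
    exact if_congr eq_comm rfl rfl
  have b : Module.Basis ι K L := .mk (linearIndependent_of_dual huv) hu.ge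
  have : FiniteDimensional K L := .of_basis b
  have hv : Submodule.span K (Set.range v) = ⊤ :=
    hvi.span_eq_top_of_card_eq_finrank' (Module.finrank_eq_card_basis b).symm
  constructor
  · intro x hx
    rw [← sum_left_dual huv hu x]
    exact Finset.sum_eq_zero fun i _ => by rw [hx, zero_smul]
  · intro y hy
    obtain ⟨c, rfl⟩ := (Submodule.mem_span_range_iff_exists_fun K).1 (hv ▸ Submodule.mem_top : y ∈ _)
    refine Finset.sum_eq_zero fun i _ => ?_
    have h := hy (u i)
    simp only [map_sum, map_smul, huv, smul_eq_mul, mul_ite, mul_one, mul_zero,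
      Finset.sum_ite_eq, Finset.mem_univ, if_true] at h
    rw [h, zero_smul]

end DualFamilies

namespace LieSuperalgebra

section

variable {R L : Type*} [CommRing R] [AddCommGroup L] [Module R L] (g : LieSuperalgebra R L)

variable {g} in
theorem toEnv_mul_toEnv {i j : ZMod 2} {x y : L} (hx : x ∈ g.part i) (hy : y ∈ g.part j) :
    g.toEnv x * g.toEnv y = g.toEnv (g.bracket x y)
      + (koszulSign i j : R) • (g.toEnv y * g.toEnv x) := by
  have h := RingQuot.mkAlgHom_rel R (EnvRel.comm (g := g) hx hy)
  rw [← Int.cast_smul_eq_zsmul R, map_sub, map_smul, map_mul, map_mul] at h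
  exact sub_eq_iff_eq_add.1 h

/-- An element of the enveloping algebra that commutes with all homogeneous elements of `g` is
central. -/
theorem mem_center_of_commute {c : g.Env}
    (h : ∀ (i : ZMod 2), ∀ x ∈ g.part i, g.toEnv x * c = c * g.toEnv x) :
    c ∈ Subalgebra.center R g.Env := by
  have h' : ∀ x, g.toEnv x * c = c * g.toEnv x := by
    intro x
    obtain ⟨y, hy, z, hz, rfl⟩ := g.exists_add x
    rw [map_add, add_mul, mul_add, h 0 y hy, h 1 z hz]
  rw [Subalgebra.mem_center_iff]
  intro a
  obtain ⟨a, rfl⟩ := RingQuot.mkAlgHom_surjective R g.EnvRel a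
  induction a using TensorAlgebra.induction with
  | algebraMap r => rw [AlgHom.commutes, Algebra.commutes]
  | ι x => exact h' x
  | mul a b ha hb => rw [map_mul, mul_assoc, hb, ← mul_assoc, ha, mul_assoc]
  | add a b ha hb => rw [map_add, add_mul, mul_add, ha, hb]

end

variable {K L : Type*} [Field K] [AddCommGroup L] [Module K L] {g : LieSuperalgebra K L}
  {B : L →ₗ[K] L →ₗ[K] K}

/-- The element `∑ u_i^* u_i` does not depend on the basis `u`: expand `u'_j` in the `u_i`, and
`u_i^*` in the `u'_j^*`. -/
theorem sum_dual_mul_eq_sum_dual_mul {ι κ : Type*} [Fintype ι] [DecidableEq ι] [Fintype κ]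
    [DecidableEq κ] (hB : B.Nondegenerate) {u v : ι → L} {u' v' : κ → L}
    (huv : ∀ i j, B (u i) (v j) = if i = j then 1 else 0)
    (hu : Submodule.span K (Set.range u) = ⊤)
    (huv' : ∀ i j, B (u' i) (v' j) = if i = j then 1 else 0)
    (hu' : Submodule.span K (Set.range u') = ⊤) :
    ∑ i, g.toEnv (v i) * g.toEnv (u i) = ∑ j, g.toEnv (v' j) * g.toEnv (u' j) := by
  have h1 : ∀ i, g.toEnv (v i) * g.toEnv (u i)
      = ∑ j, B (u' j) (v i) • (g.toEnv (v' j) * g.toEnv (u i)) := fun i => by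
    conv_lhs => rw [← sum_right_dual huv' hu' hB (v i)]
    simp [map_sum, Finset.sum_mul]
  have h2 : ∀ j, g.toEnv (v' j) * g.toEnv (u' j)
      = ∑ i, B (u' j) (v i) • (g.toEnv (v' j) * g.toEnv (u i)) := fun j => by
    conv_lhs => rw [← sum_left_dual huv hu (u' j)]
    simp [map_sum, Finset.mul_sum]
  rw [Finset.sum_congr rfl fun i _ => h1 i, Finset.sum_congr rfl fun j _ => h2 j, Finset.sum_comm]

theorem isCasimir_sum_dual_mul {ι : Type*} [Fintype ι] [DecidableEq ι]
    (hB : B.Nondegenerate) {u v : ι → L} {d : ι → ZMod 2} (hd : ∀ i, u i ∈ g.part (d i))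
    (huv : ∀ i j, B (u i) (v j) = if i = j then 1 else 0)
    (hu : Submodule.span K (Set.range u) = ⊤) :
    g.IsCasimir B (∑ i, g.toEnv (v i) * g.toEnv (u i)) where
  exists_pair := by
    let e := Fintype.equivFin ι
    refine ⟨Fintype.card ι, (Module.Basis.mk (linearIndependent_of_dual huv) hu.ge).reindex e,
      v ∘ e.symm, fun i => ?_, fun i j => ?_⟩
    · rw [Module.Basis.reindex_apply, Module.Basis.mk_apply]
      rcases parity_cases (d (e.symm i)) with h | h
      · exact Or.inl (h ▸ hd (e.symm i))
      · exact Or.inr (h ▸ hd (e.symm i))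
    · rw [Module.Basis.reindex_apply, Module.Basis.mk_apply, Function.comp_apply, huv]
      exact if_congr e.symm.injective.eq_iff rfl rfl
  eq_sum n u' v' h := sum_dual_mul_eq_sum_dual_mul hB huv hu h.2 u'.span_eq

/-- Casimir elements are central: by invariance of the form, the matrix of `ad x` in the basis `u`
is, up to signs, minus the transpose of its matrix in the dual basis `v`, so that the terms
`[x, v_i] u_i` and `v_i [x, u_i]` cancel. -/
theorem sum_dual_mul_mem_center {ι : Type*} [Fintype ι] [DecidableEq ι]
    (hB : g.IsInvariantForm B) {u v : ι → L} {d : ι → ZMod 2} (hdu : ∀ i, u i ∈ g.part (d i))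
    (hdv : ∀ i, v i ∈ g.part (d i)) (huv : ∀ i j, B (u i) (v j) = if i = j then 1 else 0)
    (hu : Submodule.span K (Set.range u) = ⊤) :
    ∑ i, g.toEnv (v i) * g.toEnv (u i) ∈ Subalgebra.center K g.Env := by
  refine g.mem_center_of_commute fun s x hx => ?_
  have h1 : ∀ i, g.toEnv x * (g.toEnv (v i) * g.toEnv (u i))
      = g.toEnv (g.bracket x (v i)) * g.toEnv (u i)
        + (koszulSign s (d i) : K) • (g.toEnv (v i) * g.toEnv (g.bracket x (u i)))
        + g.toEnv (v i) * g.toEnv (u i) * g.toEnv x := fun i => by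
    rw [← mul_assoc, toEnv_mul_toEnv hx (hdv i), add_mul, smul_mul_assoc, mul_assoc (g.toEnv (v i)),
      toEnv_mul_toEnv hx (hdu i), mul_add, smul_add, mul_smul_comm, smul_smul, ← Int.cast_mul,
      koszulSign_mul_self, Int.cast_one, one_smul, mul_assoc, add_assoc]
  have h2 : ∀ i, g.toEnv (g.bracket x (v i)) * g.toEnv (u i)
      = ∑ j, B (u j) (g.bracket x (v i)) • (g.toEnv (v j) * g.toEnv (u i)) := fun i => by
    conv_lhs => rw [← sum_right_dual huv hu hB.nondegenerate (g.bracket x (v i))]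
    simp [map_sum, Finset.sum_mul]
  have h3 : ∀ i, (koszulSign s (d i) : K) • (g.toEnv (v i) * g.toEnv (g.bracket x (u i)))
      = -∑ j, B (u i) (g.bracket x (v j)) • (g.toEnv (v i) * g.toEnv (u j)) := fun i => by
    conv_lhs => rw [← sum_left_dual huv hu (g.bracket x (u i)), map_sum, Finset.mul_sum,
      Finset.smul_sum]
    rw [← Finset.sum_neg_distrib]
    refine Finset.sum_congr rfl fun j _ => ?_
    rw [map_smul, mul_smul_comm, g.skew hx (hdu i), map_neg, LinearMap.neg_apply, map_zsmul,
      LinearMap.smul_apply, hB.invariant, ← Int.cast_smul_eq_zsmul K, smul_smul,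
      mul_neg, smul_eq_mul, ← mul_assoc, ← Int.cast_mul, koszulSign_mul_self, Int.cast_one, one_mul,
      neg_smul]
  rw [Finset.mul_sum, Finset.sum_congr rfl fun i _ => h1 i, Finset.sum_add_distrib,
    Finset.sum_add_distrib, Finset.sum_congr rfl fun i _ => h2 i,
    Finset.sum_congr rfl fun i _ => h3 i, Finset.sum_neg_distrib, Finset.sum_comm,
    add_neg_cancel, zero_add, Finset.sum_mul]

end LieSuperalgebra

/-! ### Signed counting of the positive weights -/

open scoped symmDiff

theorem rootWeight_compl {k : ℕ} (p : Finset (Fin k) × Finset (Fin k)) (i : Fin k) :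
    rootWeight pᶜ i = -rootWeight p i := by
  change (if i ∈ p.1ᶜ then (1 : ℤ) else 0) - (if i ∈ p.2ᶜ then 1 else 0)
    = -((if i ∈ p.1 then 1 else 0) - (if i ∈ p.2 then 1 else 0))
  simp only [Finset.mem_compl]
  split_ifs <;> simp_all

theorem rootWeight_eq_zero_iff {k : ℕ} {p : Finset (Fin k) × Finset (Fin k)} {i : Fin k} :
    rootWeight p i = 0 ↔ (i ∈ p.1 ↔ i ∈ p.2) := by
  simp only [rootWeight]
  split_ifs <;> simp_all

theorem isPositive_or_isPositive_compl {k : ℕ} {p : Finset (Fin k) × Finset (Fin k)}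
    (h : p.1 ≠ p.2) : IsPositive p ∨ IsPositive pᶜ := by
  have hne : ∃ i, rootWeight p i ≠ 0 := by
    by_contra! hc
    exact h (Finset.ext fun i => rootWeight_eq_zero_iff.1 (hc i))
  obtain ⟨i, hi, hmin⟩ := WellFounded.has_min (wellFounded_lt (α := Fin k))
    {i | rootWeight p i ≠ 0} hne
  have hz : ∀ j < i, rootWeight p j = 0 := fun j hj => not_not.1 fun hc => hmin j hc hj
  rcases lt_or_gt_of_ne (show rootWeight p i ≠ 0 from hi) with h0 | h0
  · refine Or.inr ⟨i, by rw [rootWeight_compl]; omega, fun j hj => ?_⟩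
    rw [rootWeight_compl, hz j hj, neg_zero]
  · exact Or.inl ⟨i, h0, hz⟩

theorem IsPositive.not_isPositive_compl {k : ℕ} {p : Finset (Fin k) × Finset (Fin k)}
    (h : IsPositive p) : ¬IsPositive pᶜ := by
  rintro ⟨j, hj, hj'⟩
  obtain ⟨i, hi, hi'⟩ := h
  rw [rootWeight_compl] at hj
  rcases lt_trichotomy i j with hij | rfl | hij
  · have := hj' i hij
    rw [rootWeight_compl] at this
    omega
  · omega
  · have := hi' j hij
    omega

/-- Positivity depends only on the entries of the weight up to a nonzero one. -/
theorem IsPositive.congr {k : ℕ} {p q : Finset (Fin k) × Finset (Fin k)} (hp : IsPositive p)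
    {j : Fin k} (hj : rootWeight p j ≠ 0) (h : ∀ i ≤ j, rootWeight q i = rootWeight p i) :
    IsPositive q := by
  obtain ⟨i, hi, hi'⟩ := hp
  have hij : i ≤ j := le_of_not_gt fun hlt => hj (hi' j hlt)
  exact ⟨i, by rwa [h i hij], fun l hl => by rw [h l (hl.le.trans hij), hi' l hl]⟩

theorem card_symmDiff_singleton {k : ℕ} (A : Finset (Fin k)) (l : Fin k) :
    (((A ∆ {l}).card : ℕ) : ZMod 2) = (A.card : ZMod 2) + 1 := by
  by_cases h : l ∈ A
  · have e : A ∆ {l} = A.erase l := by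
      ext i
      by_cases hi : i = l <;> simp [Finset.mem_symmDiff, hi, h]
    rw [e, ← Finset.card_erase_add_one h, Nat.cast_add, Nat.cast_one, add_assoc,
      parity_one_add_one, add_zero]
  · have e : A ∆ {l} = insert l A := by
      ext i
      by_cases hi : i = l <;> simp [Finset.mem_symmDiff, hi, h]
    rw [e, Finset.card_insert_of_notMem h, Nat.cast_add, Nat.cast_one]

theorem mem_symmDiff_singleton_of_ne {k : ℕ} {A : Finset (Fin k)} {i l : Fin k} (h : i ≠ l) :
    i ∈ A ∆ {l} ↔ i ∈ A := by
  simp [Finset.mem_symmDiff, h]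

theorem sum_eq_zero_of_involutive {α : Type*} [Fintype α] {F : α → ℤ} {τ : α → α}
    (hτ : Function.Involutive τ) (h : ∀ a, F (τ a) = -F a) : ∑ a, F a = 0 := by
  have h1 : ∑ a, F (τ a) = ∑ a, F a := Equiv.sum_comp hτ.toPerm F
  rw [Finset.sum_congr rfl fun a _ => h a, Finset.sum_neg_distrib] at h1
  omega

open Classical in
/-- Toggling whether `ξ_k` occurs reverses the sign and changes neither the `j`-th entry of the
weight nor, if that entry is nonzero, the positivity. -/
theorem sum_sign_mul_rootWeight_of_lt {k : ℕ} {j l : Fin k} (hj : j < l) :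
    ∑ p : Finset (Fin k) × Finset (Fin k),
      (if IsPositive p then paritySign (deg p) * rootWeight p j else 0) = 0 := by
  let τ : Finset (Fin k) × Finset (Fin k) → Finset (Fin k) × Finset (Fin k) :=
    fun p => (p.1 ∆ {l}, p.2)
  have hτ : Function.Involutive τ := fun p => Prod.ext (symmDiff_symmDiff_cancel_right _ _) rfl
  have hw : ∀ p, ∀ i ≤ j, rootWeight (τ p) i = rootWeight p i := fun p i hi => by
    simp only [rootWeight, τ, mem_symmDiff_singleton_of_ne (hi.trans_lt hj).ne]
  have hs : ∀ p, paritySign (deg (τ p)) = -paritySign (deg p) := fun p => by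
    have : deg (τ p) = deg p + 1 := by
      simp only [deg, τ, Nat.cast_add, card_symmDiff_singleton]
      ring
    rw [this]
    generalize deg p = x
    revert x
    decide
  refine sum_eq_zero_of_involutive hτ fun p => ?_
  by_cases h0 : rootWeight p j = 0
  · simp [hw p j le_rfl, h0]
  · have : IsPositive (τ p) ↔ IsPositive p :=
      ⟨fun h => h.congr (by rwa [hw p j le_rfl]) fun i hi => (hw p i hi).symm,
        fun h => h.congr h0 (hw p)⟩
    simp only [this, hs, hw p j le_rfl]
    split_ifs <;> ring

theorem sum_ite_mem_eq {k : ℕ} (l : Fin k) :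
    ∑ A : Finset (Fin k), (if l ∈ A then (1 : ℤ) else 0) = 2 ^ (k - 1) := by
  have h1 : ∑ A : Finset (Fin k), (if l ∈ Aᶜ then (1 : ℤ) else 0)
      = ∑ A : Finset (Fin k), (if l ∈ A then (1 : ℤ) else 0) :=
    Equiv.sum_comp (Equiv.ofBijective _ compl_bijective)
      (fun A : Finset (Fin k) => if l ∈ A then (1 : ℤ) else 0)
  have h2 : ∑ A : Finset (Fin k), ((if l ∈ A then (1 : ℤ) else 0) + if l ∈ Aᶜ then (1 : ℤ) else 0)
      = 2 ^ k := by
    rw [Finset.sum_congr rfl (g := fun _ => (1 : ℤ)) fun A _ => by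
      by_cases h : l ∈ A <;> simp [h]]
    simp
  rw [Finset.sum_add_distrib, h1] at h2
  obtain ⟨n, rfl⟩ : ∃ n, k = n + 1 := ⟨k - 1, by have := l.2; omega⟩
  rw [pow_succ] at h2
  simp only [Nat.add_sub_cancel]
  omega

open Classical in
/-- The terms in which an entry of the weight other than the last one is nonzero cancel under the
involution that toggles both `ξ_k` and `η_k`: it negates the last entry, preserving positivity and
parity. The remaining positive weights are those of the monomials `ξ^A η^{A ∖ {k}}` with
`k ∈ A`; each contributes `-1`. -/
theorem sum_sign_mul_rootWeight_last {k : ℕ} {l : Fin k} (hl : (l : ℕ) + 1 = k) :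
    ∑ p : Finset (Fin k) × Finset (Fin k),
      (if IsPositive p then paritySign (deg p) * rootWeight p l else 0) = -2 ^ (k - 1) := by
  have hle : ∀ i : Fin k, i ≤ l := fun i => Fin.le_def.2 (by have := i.2; omega)
  let Z : Finset (Fin k) × Finset (Fin k) → Prop := fun p => ∀ i < l, rootWeight p i = 0
  have hsplit : ∀ p : Finset (Fin k) × Finset (Fin k),
      (if IsPositive p then paritySign (deg p) * rootWeight p l else 0)
        = (if ¬Z p ∧ IsPositive p then paritySign (deg p) * rootWeight p l else 0)
          + (if p.1.erase l = p.2 then if l ∈ p.1 then -1 else 0 else 0) := by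
    rintro ⟨A, D⟩
    by_cases hZ : Z (A, D)
    · have hiff : (IsPositive (A, D)) ↔ (A.erase l = D ∧ l ∈ A) := by
        constructor
        · rintro ⟨i, hi, -⟩
          obtain rfl : i = l := by
            by_contra hne
            exact hi.ne' (hZ i (lt_of_le_of_ne (hle i) hne))
          have hmem : i ∈ A ∧ i ∉ D := by
            simp only [rootWeight] at hi
            split_ifs at hi <;> simp_all
          refine ⟨Finset.ext fun m => ?_, hmem.1⟩
          by_cases hm : m = i
          · simp [hm, hmem.2]
          · simpa [hm] using rootWeight_eq_zero_iff.1 (hZ m (lt_of_le_of_ne (hle m) hm))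
        · rintro ⟨rfl, hA⟩
          exact ⟨l, by simp [rootWeight, hA], hZ⟩
      have hval : A.erase l = D → l ∈ A → paritySign (deg (A, D)) * rootWeight (A, D) l = -1 := by
        rintro rfl hA
        have : deg (A, A.erase l) = 1 := by
          rw [deg, ← Finset.card_erase_add_one hA]
          push_cast
          generalize (((A.erase l).card : ℕ) : ZMod 2) = x
          revert x
          decide
        rw [this, paritySign_one]
        simp [rootWeight, hA]
      simp only [hZ, not_true_eq_false, false_and, if_false, zero_add, hiff]
      by_cases h1 : A.erase l = D <;> by_cases h2 : l ∈ A <;> simp [h1, h2, hval]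
    · have : A.erase l ≠ D := by
        rintro rfl
        refine hZ fun i hi => rootWeight_eq_zero_iff.2 ?_
        simp [hi.ne]
      simp [hZ, this]
  rw [Finset.sum_congr rfl fun p _ => hsplit p, Finset.sum_add_distrib]
  have hZsum : ∑ p : Finset (Fin k) × Finset (Fin k),
      (if ¬Z p ∧ IsPositive p then paritySign (deg p) * rootWeight p l else 0) = 0 := by
    let τ : Finset (Fin k) × Finset (Fin k) → Finset (Fin k) × Finset (Fin k) :=
      fun p => (p.1 ∆ {l}, p.2 ∆ {l})
    have hτ : Function.Involutive τ := fun p =>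
      Prod.ext (symmDiff_symmDiff_cancel_right _ _) (symmDiff_symmDiff_cancel_right _ _)
    have hw : ∀ p, ∀ i < l, rootWeight (τ p) i = rootWeight p i := fun p i hi => by
      simp only [rootWeight, τ, mem_symmDiff_singleton_of_ne hi.ne]
    have hwl : ∀ p, rootWeight (τ p) l = -rootWeight p l := fun p => by
      by_cases h1 : l ∈ p.1 <;> by_cases h2 : l ∈ p.2 <;>
        simp [rootWeight, τ, Finset.mem_symmDiff, h1, h2]
    have hs : ∀ p, paritySign (deg (τ p)) = paritySign (deg p) := fun p => by
      have : deg (τ p) = deg p := by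
        simp only [deg, τ, Nat.cast_add, card_symmDiff_singleton]
        rw [add_add_add_comm, parity_one_add_one, add_zero]
      rw [this]
    have hZτ : ∀ p, Z (τ p) ↔ Z p := fun p =>
      forall₂_congr fun i hi => by rw [hw p i hi]
    refine sum_eq_zero_of_involutive hτ fun p => ?_
    by_cases hZ : Z p
    · simp [hZτ, hZ]
    · obtain ⟨i, hi, h0⟩ : ∃ i, ∃ _ : i < l, rootWeight p i ≠ 0 := by
        simpa [Z] using hZ
      have : IsPositive (τ p) ↔ IsPositive p :=
        ⟨fun h => h.congr (by rwa [hw p i hi]) fun m hm => (hw p m (hm.trans_lt hi)).symm,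
          fun h => h.congr h0 fun m hm => hw p m (hm.trans_lt hi)⟩
      simp only [hZτ, this, hs, hwl]
      split_ifs <;> ring
  rw [hZsum, zero_add, Fintype.sum_prod_type]
  simp only [Finset.sum_ite_eq, Finset.mem_univ, if_true]
  rw [← sum_ite_mem_eq l, ← Finset.sum_neg_distrib]
  exact Finset.sum_congr rfl fun A _ => by split_ifs <;> simp

/-! ### The invariant form and the dual monomials of `po(0|2k)` -/

theorem integral_pd_mul {k : ℕ} (a : Fin k ⊕ Fin k) (x y : Grass k) :
    integral k (pd a x * y) = -integral k (sgn x * pd a y) := by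
  have h := integral_pd a (x * y)
  rw [pd_mul, map_add] at h
  exact eq_neg_of_add_eq_zero_left h

theorem poForm_apply {k : ℕ} (x y : Grass k) : poForm k x y = integral k (x * y) := rfl

theorem poForm_even {k : ℕ} {i j : ZMod 2} {x y : Grass k} (hx : x ∈ Grass.part i)
    (hy : y ∈ Grass.part j) (hij : i ≠ j) : poForm k x y = 0 := by
  refine integral_odd ?_
  have : i + j = 1 := by clear hx hy; revert i j; decide
  exact this ▸ SetLike.mul_mem_graded hx hy

theorem poForm_supersymm {k : ℕ} {i j : ZMod 2} {x y : Grass k} (hx : x ∈ Grass.part i)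
    (hy : y ∈ Grass.part j) : poForm k x y = koszulSign i j • poForm k y x := by
  rw [poForm_apply, poForm_apply, mul_comm_of_mem hx hy, map_zsmul]

/-- Invariance of the form: integrate `∂_a` by parts; the terms with second derivatives of `y`
cancel in pairs. -/
theorem poForm_invariant {k : ℕ} (x y z : Grass k) :
    poForm k (contact x y) z = poForm k x (contact y z) := by
  have h : ∀ a : Fin k ⊕ Fin k, integral k (pd a (sgn x) * pd a.swap y * z)
      = -integral k (x * (pd a (pd a.swap y) * z))
        + integral k (x * (pd a.swap (sgn y) * pd a z)) := fun a => by
    rw [mul_assoc, integral_pd_mul, sgn_sgn, pd_mul, mul_add, map_add, neg_add, sgn_pd, neg_mul,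
      mul_neg, map_neg, neg_neg]
  have h0 : ∑ a : Fin k ⊕ Fin k, -integral k (x * (pd a (pd a.swap y) * z)) = 0 := by
    rw [Fintype.sum_sum_type, ← Finset.sum_add_distrib]
    refine Finset.sum_eq_zero fun j _ => ?_
    simp only [Sum.swap_inl, Sum.swap_inr]
    rw [pd_comm (Sum.inr j) (Sum.inl j)]
    simp
  rw [poForm_apply, poForm_apply, contact_apply, contact_apply, Finset.sum_mul, Finset.mul_sum,
    map_sum, map_sum, Finset.sum_congr rfl fun a _ => h a, Finset.sum_add_distrib, h0, zero_add,
    ← Equiv.sum_comp (Equiv.sumComm (Fin k) (Fin k))]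
  exact Finset.sum_congr rfl fun a _ => by simp

theorem integral_setMono {k : ℕ} {S : Finset (Fin k ⊕ Fin k)} (hS : S ≠ Finset.univ) :
    integral k (setMono S) = 0 := by
  obtain ⟨a, ha⟩ : ∃ a, a ∉ S := by
    by_contra! h
    exact hS (Finset.eq_univ_iff_forall.2 h)
  exact integral_eq_zero a (pd_setMono_of_notMem ha)

theorem setMono_univ {k : ℕ} :
    setMono (Finset.univ : Finset (Fin k ⊕ Fin k)) = mono Finset.univ Finset.univ := by
  rw [mono_eq_setMono, Finset.univ_disjSum_univ]

theorem poVec_eq_setMono {k : ℕ} (p : Finset (Fin k) × Finset (Fin k)) :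
    poVec p = setMono (p.1.disjSum p.2) := mono_eq_setMono _ _

theorem poVec_compl_eq_setMono {k : ℕ} (p : Finset (Fin k) × Finset (Fin k)) :
    poVec pᶜ = setMono (p.1.disjSum p.2)ᶜ := by
  change mono p.1ᶜ p.2ᶜ = _
  rw [mono_eq_setMono]
  congr 1
  ext a
  cases a <;> simp

theorem poVec_mem {k : ℕ} (p : Finset (Fin k) × Finset (Fin k)) :
    poVec p ∈ Grass.part (k := k) (deg p) := mono_mem _ _

theorem span_poVec (k : ℕ) : Submodule.span ℂ (Set.range (poVec (k := k))) = ⊤ := by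
  rw [← span_setMono]
  congr 1
  ext x
  constructor
  · rintro ⟨p, rfl⟩
    exact ⟨_, (poVec_eq_setMono p).symm⟩
  · rintro ⟨S, rfl⟩
    exact ⟨(S.toLeft, S.toRight), rfl⟩

theorem deg_compl {k : ℕ} (p : Finset (Fin k) × Finset (Fin k)) : deg pᶜ = deg p := by
  have h1 := Finset.card_add_card_compl p.1
  have h2 := Finset.card_add_card_compl p.2
  change (((p.1ᶜ.card + p.2ᶜ.card : ℕ)) : ZMod 2) = ((p.1.card + p.2.card : ℕ) : ZMod 2)
  rw [ZMod.natCast_eq_natCast_iff']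
  rw [← h2] at h1
  omega

theorem poForm_poVec_compl {k : ℕ} (p : Finset (Fin k) × Finset (Fin k)) :
    ∃ ε : ℂ, ε * ε = 1 ∧ poVec p * poVec pᶜ = ε • mono Finset.univ Finset.univ ∧
      poForm k (poVec p) (poVec pᶜ) = ε := by
  obtain ⟨ε, hε, h⟩ := setMono_mul_of_disjoint
    (disjoint_compl_right : Disjoint (p.1.disjSum p.2) (p.1.disjSum p.2)ᶜ)
  rw [← poVec_eq_setMono, ← poVec_compl_eq_setMono, Finset.union_compl, setMono_univ] at h
  refine ⟨ε, hε, h, ?_⟩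
  rw [poForm_apply, h, map_smul, integral_mono_univ, smul_eq_mul, mul_one]

theorem poDual_eq {k : ℕ} (p : Finset (Fin k) × Finset (Fin k)) :
    poDual p = (poForm k (poVec p) (poVec pᶜ))⁻¹ • poVec pᶜ := rfl

theorem poVec_mul_poDual {k : ℕ} (p : Finset (Fin k) × Finset (Fin k)) :
    poVec p * poDual p = mono Finset.univ Finset.univ := by
  obtain ⟨ε, hε, h1, h2⟩ := poForm_poVec_compl p
  rw [poDual_eq, h2, mul_smul_comm, h1, smul_smul, inv_mul_cancel₀ (left_ne_zero_of_mul_eq_one hε),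
    one_smul]

theorem poDual_mem {k : ℕ} (p : Finset (Fin k) × Finset (Fin k)) :
    poDual p ∈ Grass.part (k := k) (deg p) := by
  rw [poDual_eq, ← deg_compl]
  exact Submodule.smul_mem _ _ (poVec_mem _)

theorem poForm_poVec_poDual {k : ℕ} (p q : Finset (Fin k) × Finset (Fin k)) :
    poForm k (poVec p) (poDual q) = if p = q then 1 else 0 := by
  split_ifs with h
  · rw [← h, poForm_apply, poVec_mul_poDual, integral_mono_univ]
  · rw [poDual_eq, map_smul, poForm_apply (poVec p), poVec_eq_setMono p, poVec_compl_eq_setMono]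
    by_cases hd : Disjoint (p.1.disjSum p.2) (q.1.disjSum q.2)ᶜ
    · obtain ⟨ε, -, hε⟩ := setMono_mul_of_disjoint hd
      rw [hε, map_smul, integral_setMono, smul_zero, smul_zero]
      intro hu
      have h1 := disjoint_compl_right_iff.1 hd
      have h2 : q.1.disjSum q.2 ≤ p.1.disjSum p.2 := by
        intro a ha
        have := Finset.mem_univ a
        rw [← hu, Finset.mem_union, Finset.mem_compl] at this
        exact this.resolve_right (not_not.2 ha)
      have := Finset.disjSum_inj.1 (le_antisymm h1 h2)
      exact h (Prod.ext this.1 this.2)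
    · rw [setMono_mul_of_not_disjoint hd, map_zero, smul_zero]

theorem po_isInvariantForm (k : ℕ) : (po k).IsInvariantForm (poForm k) where
  even := poForm_even
  supersymm := poForm_supersymm
  invariant := poForm_invariant
  nondegenerate := nondegenerate_of_dual poForm_poVec_poDual (span_poVec k)

/-- The normalization factors in the duals of `p` and of its complement differ by the sign
`(-1)^{p(e)}`, by supersymmetry of the form. -/
theorem poDual_compl {k : ℕ} (p : Finset (Fin k) × Finset (Fin k)) :
    poDual pᶜ = ((paritySign (deg p) : ℂ) * (poForm k (poVec p) (poVec pᶜ))⁻¹) • poVec p := by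
  have h := poForm_supersymm (poVec_mem pᶜ) (poVec_mem p)
  rw [deg_compl, koszulSign_self] at h
  have hs : ((paritySign (deg p) : ℂ))⁻¹ = (paritySign (deg p) : ℂ) := by
    refine inv_eq_of_mul_eq_one_left ?_
    rw [← Int.cast_mul, paritySign_mul_self, Int.cast_one]
  rw [poDual_eq, compl_compl, h, zsmul_eq_mul, mul_inv, hs]

/-! ### The commutators of the root vectors with their duals -/

/-- Applying `∂_{θ'} ∂_θ`, for the conjugate `θ'` of `θ`, to `e e^* = ξ_1 ⋯ ξ_k η_1 ⋯ η_k` gives,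
up to the sign, the term of `[e, e^*]` with `∂e/∂θ ∂e^*/∂θ'`: no other term of the Leibniz rule
survives, as `e` does not contain `θ'` and `e^*` does not contain `θ`. -/
theorem contact_poVec_poDual {k : ℕ} (p : Finset (Fin k) × Finset (Fin k)) :
    contact (poVec p) (poDual p) = -∑ j, (rootWeight p j : ℂ) •
      pd (Sum.inr j) (pd (Sum.inl j) (mono (Finset.univ : Finset (Fin k)) Finset.univ)) := by
  have hu : ∀ a, a ∉ p.1.disjSum p.2 → pd a (poVec p) = 0 := fun a ha => by
    rw [poVec_eq_setMono]
    exact pd_setMono_of_notMem ha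
  have hv : ∀ a, a ∈ p.1.disjSum p.2 → pd a (poDual p) = 0 := fun a ha => by
    rw [poDual_eq, poVec_compl_eq_setMono, map_smul, pd_setMono_of_notMem (by simpa using ha),
      smul_zero]
  have key : ∀ a : Fin k ⊕ Fin k, pd a (sgn (poVec p)) * pd a.swap (poDual p)
      = if a ∈ p.1.disjSum p.2 ∧ a.swap ∉ p.1.disjSum p.2 then
          -pd a.swap (pd a (mono (Finset.univ : Finset (Fin k)) Finset.univ)) else 0 := by
    intro a
    split_ifs with h
    · rw [← poVec_mul_poDual p, pd_mul, hv a h.1, mul_zero, add_zero, pd_mul, pd_comm, hu _ h.2,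
        map_zero, neg_zero, zero_mul, zero_add, sgn_pd, neg_mul, neg_neg]
    · rw [not_and_or, not_not] at h
      rcases h with h | h
      · rw [sgn_of_mem (poVec_mem p), map_zsmul, hu a h, smul_zero, zero_mul]
      · rw [hv _ h, mul_zero]
  rw [contact_apply, Finset.sum_congr rfl fun a _ => key a, Fintype.sum_sum_type,
    ← Finset.sum_add_distrib, ← Finset.sum_neg_distrib]
  refine Finset.sum_congr rfl fun j _ => ?_
  simp only [Sum.swap_inl, Sum.swap_inr, Finset.inl_mem_disjSum, Finset.inr_mem_disjSum, rootWeight]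
  rw [pd_comm (Sum.inl j) (Sum.inr j)]
  by_cases h1 : j ∈ p.1 <;> by_cases h2 : j ∈ p.2 <;> simp [h1, h2]

open Classical in
theorem sum_sign_smul_contact {k : ℕ} {l : Fin k} (hl : (l : ℕ) + 1 = k) :
    ∑ p : Finset (Fin k) × Finset (Fin k),
      (if IsPositive p then (paritySign (deg p) : ℂ) • contact (poVec p) (poDual p) else 0)
      = (-2 : ℂ) ^ (k - 1) • poVec (Finset.univ.erase l, Finset.univ.erase l) := by
  have h1 : ∀ p : Finset (Fin k) × Finset (Fin k),
      (if IsPositive p then (paritySign (deg p) : ℂ) • contact (poVec p) (poDual p) else 0)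
        = -∑ j, ((if IsPositive p then paritySign (deg p) * rootWeight p j else 0 : ℤ) : ℂ) •
          pd (Sum.inr j) (pd (Sum.inl j) (mono (Finset.univ : Finset (Fin k)) Finset.univ)) := by
    intro p
    split_ifs
    · rw [contact_poVec_poDual, smul_neg, Finset.smul_sum]
      simp only [smul_smul, Int.cast_mul]
    · simp
  rw [Finset.sum_congr rfl fun p _ => h1 p, Finset.sum_neg_distrib, Finset.sum_comm]
  simp only [← Finset.sum_smul, ← Int.cast_sum]
  rw [Finset.sum_eq_single l, sum_sign_mul_rootWeight_last hl, pd_pd_mono_univ, ← neg_smul,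
    smul_smul]
  · congr 1
    push_cast
    rw [neg_neg, ← mul_pow]
    norm_num
  · intro j _ hj
    have : j < l := lt_of_le_of_ne (Fin.le_def.2 (by have := j.2; omega)) hj
    rw [sum_sign_mul_rootWeight_of_lt this, Int.cast_zero, zero_smul]
  · simp

open Classical in
/-- The common computation for `po(0|2k)` and `sh(0|2k)`, with `T f` standing for `K_f` and for
`H_f`. The dual pairs of the negative roots are, up to sign, those of the positive roots in the
reverse order, and reordering them gives the sum of the commutators `[e_α, e_α^*]`. -/
theorem sum_dual_mul_eq {k : ℕ} {L : Type*} [AddCommGroup L] [Module ℂ L]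
    (g : LieSuperalgebra ℂ L) (T : Grass k →ₗ[ℂ] L) {l : Fin k} (hl : (l : ℕ) + 1 = k)
    (hT : ∀ (i : ZMod 2), ∀ x ∈ Grass.part i, T x ∈ g.part i)
    (hpos : ∀ p, IsPositive p →
      g.bracket (T (poVec p)) (T (poDual p)) = T (contact (poVec p) (poDual p)))
    (hdiag : ∀ J, g.bracket (T (poVec (J, J))) (T (poDual (J, J))) = 0) :
    ∑ p, g.toEnv (T (poDual p)) * g.toEnv (T (poVec p))
      = (2 : ℂ) • ∑ p : {p : Finset (Fin k) × Finset (Fin k) // IsPositive p},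
          g.toEnv (T (poDual p.1)) * g.toEnv (T (poVec p.1))
        + ∑ J, g.toEnv (T (poVec (J, J))) * g.toEnv (T (poDual (J, J)))
        + (-2 : ℂ) ^ (k - 1) •
          g.toEnv (T (poVec (Finset.univ.erase l, Finset.univ.erase l))) := by
  set F : Finset (Fin k) × Finset (Fin k) → g.Env :=
    fun p => g.toEnv (T (poDual p)) * g.toEnv (T (poVec p)) with hF
  have hu := fun p => hT _ _ (poVec_mem (k := k) p)
  have hv := fun p => hT _ _ (poDual_mem (k := k) p)
  have hcompl : ∀ p, IsPositive p → F pᶜ = F p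
      + g.toEnv (T ((paritySign (deg p) : ℂ) • contact (poVec p) (poDual p))) := by
    intro p hp
    have h1 : F pᶜ = (paritySign (deg p) : ℂ) •
        (g.toEnv (T (poVec p)) * g.toEnv (T (poDual p))) := by
      simp only [hF]
      rw [poDual_compl, poDual_eq p]
      simp only [map_smul, smul_mul_assoc, mul_smul_comm, smul_smul]
    rw [h1, LieSuperalgebra.toEnv_mul_toEnv (hu p) (hv p), koszulSign_self, hpos p hp, smul_add,
      smul_smul, ← Int.cast_mul, paritySign_mul_self, Int.cast_one, one_smul, map_smul, map_smul,
      add_comm]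
  have hJ : ∀ J, F (J, J) = g.toEnv (T (poVec (J, J))) * g.toEnv (T (poDual (J, J))) := by
    intro J
    have h0 : deg (J, J) = 0 := by
      rw [deg, ← two_mul, Nat.cast_mul]
      exact zero_mul _
    rw [LieSuperalgebra.toEnv_mul_toEnv (hu _) (hv _), hdiag, map_zero, zero_add, h0,
      koszulSign_zero_left, Int.cast_one, one_smul]
  have hsplit : ∀ p : Finset (Fin k) × Finset (Fin k), F p = (if IsPositive p then F p else 0)
      + (if IsPositive pᶜ then F p else 0) + (if p.1 = p.2 then F p else 0) := by
    intro p
    by_cases h : p.1 = p.2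
    · have h1 : ¬IsPositive p := fun hp => hp.fst_ne_snd h
      have h2 : ¬IsPositive pᶜ := fun hp => hp.fst_ne_snd (congrArg compl h)
      simp [h, h1, h2]
    · rcases isPositive_or_isPositive_compl h with hp | hp
      · simp [h, hp, hp.not_isPositive_compl]
      · have h1 : ¬IsPositive p := compl_compl p ▸ hp.not_isPositive_compl
        simp [h, hp, h1]
  have hneg : ∑ p, (if IsPositive pᶜ then F p else 0) = ∑ p, (if IsPositive p then F p else 0)
      + (-2 : ℂ) ^ (k - 1) •
          g.toEnv (T (poVec (Finset.univ.erase l, Finset.univ.erase l))) := by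
    rw [← map_smul, ← map_smul, ← sum_sign_smul_contact hl, map_sum, map_sum,
      ← Finset.sum_add_distrib,
      ← Equiv.sum_comp (Equiv.ofBijective _ (compl_bijective
        (α := Finset (Fin k) × Finset (Fin k))))]
    refine Finset.sum_congr rfl fun p _ => ?_
    rw [Equiv.ofBijective_apply, compl_compl]
    split_ifs with hp
    · exact hcompl p hp
    · simp
  have hdiag' : ∑ p : Finset (Fin k) × Finset (Fin k), (if p.1 = p.2 then F p else 0)
      = ∑ J, F (J, J) := by
    rw [Fintype.sum_prod_type]
    simp
  have hsub : ∑ p, (if IsPositive p then F p else 0)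
      = ∑ p : {p : Finset (Fin k) × Finset (Fin k) // IsPositive p}, F p.1 := by
    refine (Fintype.sum_of_injective Subtype.val Subtype.val_injective _ _ ?_ ?_).symm
    · intro p hp
      exact if_neg fun h => hp ⟨⟨p, h⟩, rfl⟩
    · intro p
      exact (if_pos p.2).symm
  rw [Finset.sum_congr rfl fun p _ => hsplit p, Finset.sum_add_distrib, Finset.sum_add_distrib,
    hneg, hdiag', hsub, Finset.sum_congr rfl fun J _ => hJ J, two_smul]
  abel

theorem contact_poVec_poDual_diag {k : ℕ} (J : Finset (Fin k)) :
    contact (poVec (J, J)) (poDual (J, J)) = 0 := by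
  rw [contact_poVec_poDual, neg_eq_zero]
  exact Finset.sum_eq_zero fun j _ => by simp [rootWeight]

theorem filter_eq_erase {k : ℕ} {l : Fin k} (hl : (l : ℕ) + 1 = k) :
    (Finset.univ.filter fun i : Fin k => (i : ℕ) + 1 < k) = Finset.univ.erase l := by
  ext i
  have := i.2
  simp only [Finset.mem_filter, Finset.mem_univ, true_and, Finset.mem_erase, and_true, ne_eq,
    Fin.ext_iff]
  omega

theorem poC2_eq_sum {k : ℕ} (hk : 1 ≤ k) :
    poC2 k = ∑ p, (po k).toEnv (poDual p) * (po k).toEnv (poVec p) := by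
  have hl : ((⟨k - 1, by omega⟩ : Fin k) : ℕ) + 1 = k := by simp only; omega
  rw [poC2, filter_eq_erase hl]
  exact (sum_dual_mul_eq (po k) LinearMap.id hl (fun _ _ hx => hx) (fun _ _ => rfl)
    contact_poVec_poDual_diag).symm

/-! ### The special Hamiltonian superalgebra -/

/-- The linear map `f ↦ H_f` from functions with zero integral to `sh(0|2k)`, extended to all
functions by sending `ξ_1 ⋯ ξ_k η_1 ⋯ η_k` to `0`. -/
noncomputable def shProj (k : ℕ) : Grass k →ₗ[ℂ] ShSpace k :=
  (spoCenter k).mkQ ∘ₗ LinearMap.codRestrict (spoSubmodule k)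
    (LinearMap.id - (integral k).smulRight (mono Finset.univ Finset.univ)) (fun f => by
      change integral k _ = 0
      simp [integral_mono_univ])

theorem shProj_of_integral {k : ℕ} {f : Grass k} (hf : integral k f = 0) :
    shProj k f = shH f hf := by
  refine congrArg (spoCenter k).mkQ (Subtype.ext ?_)
  simp [hf]

theorem shProj_mono_univ (k : ℕ) : shProj k (mono Finset.univ Finset.univ) = 0 := by
  refine (congrArg (spoCenter k).mkQ (a₂ := 0) (Subtype.ext ?_)).trans (map_zero _)
  simp [integral_mono_univ]

theorem shProj_one {k : ℕ} (hk : 1 ≤ k) : shProj k 1 = 0 := by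
  have h1 : integral k 1 = 0 := integral_eq_zero (Sum.inl ⟨0, hk⟩) (pd_one _)
  rw [shProj_of_integral h1]
  exact (Submodule.Quotient.mk_eq_zero _).2 (Submodule.mem_span_singleton_self _)

theorem shVec_eq {k : ℕ} (p : Finset (Fin k) × Finset (Fin k))
    (hp : p ≠ (Finset.univ, Finset.univ)) : shVec p hp = shProj k (poVec p) :=
  (shProj_of_integral _).symm

theorem shDual_eq {k : ℕ} (p : Finset (Fin k) × Finset (Fin k)) (hp : p ≠ (∅, ∅)) :
    shDual p hp = shProj k (poDual p) :=
  (shProj_of_integral _).symm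

theorem poVec_empty (k : ℕ) : poVec ((∅, ∅) : Finset (Fin k) × Finset (Fin k)) = 1 := by
  simp [poVec, mono]

theorem shProj_poVec_empty {k : ℕ} (hk : 1 ≤ k) : shProj k (poVec (∅, ∅)) = 0 := by
  rw [poVec_empty, shProj_one hk]

theorem shProj_poVec_univ (k : ℕ) : shProj k (poVec (Finset.univ, Finset.univ)) = 0 :=
  shProj_mono_univ k

theorem shProj_mem {k : ℕ} {i : ZMod 2} {x : Grass k} (hx : x ∈ Grass.part i) :
    shProj k x ∈ (sh k).part i := by
  refine ⟨_, ?_, rfl⟩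
  change x - integral k x • mono Finset.univ Finset.univ ∈ Grass.part i
  refine Submodule.sub_mem _ hx ?_
  rcases parity_cases i with rfl | rfl
  · have h := mono_mem (Finset.univ : Finset (Fin k)) Finset.univ
    have h0 : deg ((Finset.univ, Finset.univ) : Finset (Fin k) × Finset (Fin k)) = 0 := by
      rw [deg, ← two_mul, Nat.cast_mul]
      exact zero_mul _
    rw [h0] at h
    exact Submodule.smul_mem _ _ h
  · rw [integral_odd hx, zero_smul]
    exact Submodule.zero_mem _

theorem sh_bracket_shProj {k : ℕ} {f h : Grass k} (hf : integral k f = 0)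
    (hh : integral k h = 0) :
    (sh k).bracket (shProj k f) (shProj k h) = shProj k (contact f h) := by
  rw [shProj_of_integral hf, shProj_of_integral hh, shProj_of_integral (integral_contact f h)]
  rfl

/-- The pairs `(A, B)` for which `H_{ξ^A η^B}` belongs to the basis of `sh(0|2k)`. -/
abbrev ShIndex (k : ℕ) : Type :=
  {p : Finset (Fin k) × Finset (Fin k) // p ≠ (∅, ∅) ∧ p ≠ (Finset.univ, Finset.univ)}

theorem shForm_shVec_shDual {k : ℕ} (p q : Finset (Fin k) × Finset (Fin k))
    (hp : p ≠ (Finset.univ, Finset.univ)) (hq : q ≠ (∅, ∅)) :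
    shForm k (shVec p hp) (shDual q hq) = if p = q then 1 else 0 :=
  poForm_poVec_poDual p q

theorem shForm_shProj {k : ℕ} (p q : ShIndex k) :
    shForm k (shProj k (poVec p.1)) (shProj k (poDual q.1)) = if p = q then 1 else 0 := by
  rw [← shVec_eq p.1 p.2.2, ← shDual_eq q.1 q.2.1, shForm_shVec_shDual]
  exact if_congr Subtype.ext_iff.symm rfl rfl

theorem span_shProj_poVec {k : ℕ} (hk : 1 ≤ k) :
    Submodule.span ℂ (Set.range fun p : ShIndex k => shProj k (poVec p.1)) = ⊤ := by
  refine Submodule.eq_top_iff'.2 fun x => ?_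
  obtain ⟨⟨f, hf⟩, rfl⟩ := (spoCenter k).mkQ_surjective x
  change shH f hf ∈ _
  rw [← shProj_of_integral hf]
  have h : f ∈ Submodule.span ℂ (Set.range (poVec (k := k))) := span_poVec k ▸ Submodule.mem_top
  clear hf
  induction h using Submodule.span_induction with
  | mem y hy =>
    obtain ⟨p, rfl⟩ := hy
    by_cases h0 : p = (∅, ∅)
    · rw [h0, shProj_poVec_empty hk]
      exact Submodule.zero_mem _
    · by_cases h1 : p = (Finset.univ, Finset.univ)
      · rw [h1, shProj_poVec_univ]
        exact Submodule.zero_mem _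
      · exact Submodule.subset_span ⟨⟨p, h0, h1⟩, rfl⟩
  | zero => rw [map_zero]; exact Submodule.zero_mem _
  | add y z _ _ hy hz => rw [map_add]; exact Submodule.add_mem _ hy hz
  | smul c y _ hy => rw [map_smul]; exact Submodule.smul_mem _ _ hy

theorem sh_isInvariantForm {k : ℕ} (hk : 1 ≤ k) : (sh k).IsInvariantForm (shForm k) where
  even := by
    rintro i j _ _ ⟨x, hx, rfl⟩ ⟨y, hy, rfl⟩ hij
    exact poForm_even hx hy hij
  supersymm := by
    rintro i j _ _ ⟨x, hx, rfl⟩ ⟨y, hy, rfl⟩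
    exact poForm_supersymm hx hy
  invariant := by
    intro x y z
    obtain ⟨x, rfl⟩ := (spoCenter k).mkQ_surjective x
    obtain ⟨y, rfl⟩ := (spoCenter k).mkQ_surjective y
    obtain ⟨z, rfl⟩ := (spoCenter k).mkQ_surjective z
    exact poForm_invariant (x : Grass k) y z
  nondegenerate := nondegenerate_of_dual shForm_shProj (span_shProj_poVec hk)

theorem shC2_eq_sum {k : ℕ} (hk : 1 ≤ k) :
    shC2 k hk = ∑ p : ShIndex k,
      (sh k).toEnv (shProj k (poDual p.1)) * (sh k).toEnv (shProj k (poVec p.1)) := by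
  have hl : ((⟨k - 1, by omega⟩ : Fin k) : ℕ) + 1 = k := by simp only; omega
  have hsum := sum_dual_mul_eq (sh k) (shProj k) hl (fun _ _ hx => shProj_mem hx)
    (fun p hp => sh_bracket_shProj (integral_mono hp.ne_univ) (integral_poDual hp.ne_empty))
    (fun J => by
      by_cases h0 : J = ∅
      · rw [h0, shProj_poVec_empty hk, map_zero, LinearMap.zero_apply]
      · by_cases h1 : J = Finset.univ
        · rw [h1, shProj_poVec_univ, map_zero, LinearMap.zero_apply]
        · have hu : integral k (poVec (J, J)) = 0 :=
            integral_mono fun e => h1 (congrArg Prod.fst e)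
          have hv : integral k (poDual (J, J)) = 0 :=
            integral_poDual fun e => h0 (congrArg Prod.fst e)
          rw [sh_bracket_shProj hu hv, contact_poVec_poDual_diag, map_zero])
  have hall : ∑ p : ShIndex k,
      (sh k).toEnv (shProj k (poDual p.1)) * (sh k).toEnv (shProj k (poVec p.1))
      = ∑ p, (sh k).toEnv (shProj k (poDual p)) * (sh k).toEnv (shProj k (poVec p)) := by
    refine Fintype.sum_of_injective Subtype.val Subtype.val_injective _ _ ?_ fun _ => rfl
    intro p hp
    by_cases h0 : p = (∅, ∅)
    · rw [h0, shProj_poVec_empty hk, map_zero, mul_zero]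
    · by_cases h1 : p = (Finset.univ, Finset.univ)
      · rw [h1, shProj_poVec_univ, map_zero, mul_zero]
      · exact absurd ⟨⟨p, h0, h1⟩, rfl⟩ hp
  have hJ : ∑ J : {J : Finset (Fin k) // J ≠ ∅ ∧ J ≠ Finset.univ},
      (sh k).toEnv (shProj k (poVec (J.1, J.1))) * (sh k).toEnv (shProj k (poDual (J.1, J.1)))
      = ∑ J, (sh k).toEnv (shProj k (poVec (J, J))) * (sh k).toEnv (shProj k (poDual (J, J))) := by
    refine Fintype.sum_of_injective Subtype.val Subtype.val_injective _ _ ?_ fun _ => rfl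
    intro J hJ
    by_cases h0 : J = ∅
    · rw [h0, shProj_poVec_empty hk, map_zero, zero_mul]
    · by_cases h1 : J = Finset.univ
      · rw [h1, shProj_poVec_univ, map_zero, zero_mul]
      · exact absurd ⟨⟨J, h0, h1⟩, rfl⟩ hJ
  rw [hall, hsum, ← hJ, ← filter_eq_erase hl, shC2]
  simp only [shVec_eq, shDual_eq]

/-! ### The Casimir elements -/

theorem lemma2 (k : ℕ) (hk : 1 ≤ k) :
    -- the form on `po(0|2k)`, the right dual vectors, the Casimir element and its centrality
    ((po k).IsInvariantForm (poForm k) ∧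
      (∀ p q : Finset (Fin k) × Finset (Fin k),
        poForm k (poVec p) (poDual q) = if p = q then 1 else 0) ∧
      (po k).IsCasimir (poForm k) (poC2 k) ∧
      poC2 k ∈ Subalgebra.center ℂ (po k).Env) ∧
    -- the same for `sh(0|2k)`
    ((sh k).IsInvariantForm (shForm k) ∧
      (∀ (p q : Finset (Fin k) × Finset (Fin k)) (hp : p ≠ (Finset.univ, Finset.univ))
        (hq : q ≠ (∅, ∅)),
        shForm k (shVec p hp) (shDual q hq) = if p = q then 1 else 0) ∧
      (sh k).IsCasimir (shForm k) (shC2 k hk) ∧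
      shC2 k hk ∈ Subalgebra.center ℂ (sh k).Env) := by
  have hpo := po_isInvariantForm k
  have hsh := sh_isInvariantForm hk
  refine ⟨⟨hpo, poForm_poVec_poDual, ?_, ?_⟩, hsh, shForm_shVec_shDual, ?_, ?_⟩
  · rw [poC2_eq_sum hk]
    exact LieSuperalgebra.isCasimir_sum_dual_mul hpo.nondegenerate poVec_mem poForm_poVec_poDual
      (span_poVec k)
  · rw [poC2_eq_sum hk]
    exact LieSuperalgebra.sum_dual_mul_mem_center hpo poVec_mem poDual_mem poForm_poVec_poDual
      (span_poVec k)
  · rw [shC2_eq_sum hk]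
    exact LieSuperalgebra.isCasimir_sum_dual_mul hsh.nondegenerate
      (fun p => shProj_mem (poVec_mem p.1)) shForm_shProj (span_shProj_poVec hk)
  · rw [shC2_eq_sum hk]
    exact LieSuperalgebra.sum_dual_mul_mem_center hsh (fun p => shProj_mem (poVec_mem p.1))
      (fun p => shProj_mem (poDual_mem p.1)) shForm_shProj (span_shProj_poVec hk)
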